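/- **Setup.** Let $k$ be an arbitrary field. For a field $K\supseteq k$, let $S=K[x_0,\dots,x_r]$, and for a finite set $\Gamma\subset\mathbb P^r(K)$ let $I_\Gamma\subset S$ be its homogeneous ideal, generated by the forms vanishing on $\Gamma$. Let $\beta_{i,j}=\dim_K\operatorname{Tor}_i^S(S/I_\Gamma,K)_j$ be the graded Betti numbers of $S/I_\Gamma$, i.e. the number of generators of degree $j$ of the $i$-th free module in the minimal graded free resolution of $S/I_\Gamma$. Let $d$ be the least degree of a nonzero form in $I_\Gamma$, and define the integers $b_j$ by $\sum_n \dim_K (S/I_\Gamma)_n\,t^n=\big(\sum_j b_jt^j\big)/(1-t)^{r+1}$. The expected Betti numbers are $\tilde\beta_{0,0}=1$, $\tilde\beta_{i,j}=\max\big((-1)^i b_j,0\big)$ for $i\ge 1$ and $j\in\{i+d-1,\,i+d\}$, and $\tilde\beta_{i,j}=0$ otherwise; for a general set of points they are lower bounds for the $\beta_{i,j}$. The Minimal Resolution Conjecture (MRC) holds for $\Gamma$ if $\beta_{i,j}=\tilde\beta_{i,j}$ for all $i,j$. We say that the MRC fails for a general set of $\gamma$ points in $\mathbb P^r$ if there is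 a nonempty Zariski open subset of $(\mathbb P^r)^\gamma$, defined over $k$, such that for every extension field $K$ of $k$ the MRC does not hold for $\Gamma=\{p_1,\dots,p_\gamma\}$ whenever $(p_1,\dots,p_\gamma)$ is a $K$-point of this open subset. **Theorem.** The MRC fails for a general set of $\gamma$ points in $\mathbb P^r$ whenever $r\ge 6$, $r\ne 9$ and $$r+2+\sqrt{r+2}\;\le\;\gamma\;\le\; r+\frac{3+\sqrt{8r+1}}{2},$$ and also when $(r,\gamma)=(8,13)$ or $(r,\gamma)=(15,21)$. Moreover, for each $r\ge 6$, $r\neq 9$, the number $N(r)$ of integers $\gamma$ in the displayed range satisfies $\big|N(r)-(\sqrt2-1)\sqrt r\big|<2$. -/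

import Mathlib

open scoped LinearAlgebra.Projectivization

universe u

namespace PointsMRC

/-- The polynomial ring `S = K[x_0, …, x_r]`, the homogeneous coordinate ring of `ℙ^r`. -/
abbrev CoordRing (K : Type u) [Field K] (r : ℕ) : Type u := MvPolynomial (Fin (r + 1)) K

section Ideals

variable {K : Type u} [Field K] {r : ℕ}

/-- The homogeneous ideal of a family of points of `ℙ^r`: it is generated by the forms that
vanish at all of them. (Vanishing of a form does not depend on the representative. Only forms
are used, so that the definition is the correct one over finite fields as well.) -/
noncomputable def pointsIdeal {γ : ℕ} (p : Fin γ → ℙ K (Fin (r + 1) → K)) : Ideal (CoordRing K r) :=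
  Ideal.span {F | (∃ n, F.IsHomogeneous n) ∧ ∀ i, MvPolynomial.eval (p i).rep F = 0}

/-- The Hilbert function `n ↦ dim_K (S/I)_n`. -/
noncomputable def hilbertFn (I : Ideal (CoordRing K r)) (n : ℕ) : ℕ :=
  Module.finrank K
    ((MvPolynomial.homogeneousSubmodule (Fin (r + 1)) K n).map
      (Ideal.Quotient.mkₐ K I).toLinearMap)

/-- The integers `b_j` determined by `∑_n dim (S/I)_n t^n = (∑_j b_j t^j) / (1 - t)^(r+1)`. -/
noncomputable def hilbertNumerator (I : Ideal (CoordRing K r)) (j : ℕ) : ℤ :=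
  PowerSeries.coeff j
    ((PowerSeries.mk fun n => (hilbertFn I n : ℤ)) * (1 - PowerSeries.X) ^ (r + 1))

/-- The least degree of a nonzero form in `I`. -/
noncomputable def initialDegree (I : Ideal (CoordRing K r)) : ℕ :=
  sInf {n | ∃ F ∈ I, F ≠ 0 ∧ F.IsHomogeneous n}

/-- The expected graded Betti numbers of `S/I`, the lower bound that the Hilbert function gives
for the ideal `I` of a general set of points. With `d` the initial degree of such an ideal, the
Betti numbers `β_{i,j}` with `i ≥ 1` vanish unless `j = i + d - 1` or `j = i + d`. So at most two
of them, in consecutive homological degrees, contribute to `∑_i (-1)^i β_{i,j} = b_j`, and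
`β_{i,j} ≥ max ((-1)^i b_j, 0)` at these positions. -/
noncomputable def expectedBetti (I : Ideal (CoordRing K r)) (i j : ℕ) : ℤ :=
  if i = 0 then (if j = 0 then 1 else 0)
  else if j + 1 = i + initialDegree I ∨ j = i + initialDegree I then
    max ((-1) ^ i * hilbertNumerator I j) 0
  else 0

/-- A minimal graded free resolution
`⋯ → F_2 → F_1 → F_0 → S/I → 0`, where `F_i = ⨁_a S(-deg i a)` is free of rank `rank i` with
basis vectors of degrees `deg i a`, and the differentials are given by matrices. -/
structure MinimalFreeResolution (I : Ideal (CoordRing K r)) where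
  /-- the rank of `F_i` -/
  rank : ℕ → ℕ
  /-- the degrees of the basis vectors of `F_i` -/
  deg : ∀ i, Fin (rank i) → ℕ
  /-- the matrix of `F_{i+1} → F_i` -/
  d : ∀ i, Matrix (Fin (rank i)) (Fin (rank (i + 1))) (CoordRing K r)
  /-- the augmentation `F_0 → S/I` -/
  aug : (Fin (rank 0) → CoordRing K r) →ₗ[CoordRing K r] CoordRing K r ⧸ I
  /-- the differentials preserve degrees: the entry `(b, a)` is homogeneous of degree
  `deg (i+1) a - deg i b` (and zero if this is negative) -/
  d_homogeneous : ∀ i b a, ∀ m ∈ (d i b a).support, m.degree + deg i b = deg (i + 1) a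
  /-- the augmentation preserves degrees -/
  aug_homogeneous : ∀ a, ∃ F : CoordRing K r, F.IsHomogeneous (deg 0 a) ∧
    aug (Pi.single a 1) = Ideal.Quotient.mk I F
  aug_surjective : Function.Surjective aug
  exact_zero : Function.Exact (d 0).mulVecLin aug
  exact_succ : ∀ i, Function.Exact (d (i + 1)).mulVecLin (d i).mulVecLin
  /-- minimality: the entries of the differentials lie in the ideal `(x_0, …, x_r)` -/
  minimal : ∀ i b a, MvPolynomial.constantCoeff (d i b a) = 0

/-- The number of basis vectors of degree `j` in `F_i`; this is the graded Betti number
`β_{i,j} = dim_K Tor_i^S(S/I, K)_j`. -/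
def MinimalFreeResolution.betti {I : Ideal (CoordRing K r)} (F : MinimalFreeResolution I)
    (i j : ℕ) : ℕ :=
  Fintype.card {a : Fin (F.rank i) // F.deg i a = j}

/-- The conclusion of the Minimal Resolution Conjecture for a family of points: the graded Betti
numbers of `S/I`, read off the minimal graded free resolution, are the expected ones. -/
def SatisfiesMRC {γ : ℕ} (p : Fin γ → ℙ K (Fin (r + 1) → K)) : Prop :=
  ∃ F : MinimalFreeResolution (pointsIdeal p),
    ∀ i j, (F.betti i j : ℤ) = expectedBetti (pointsIdeal p) i j

end Ideals

/-- The property `P` holds for a general set of `γ` points of `ℙ^r` over `k`: there is a nonempty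
Zariski open set of `γ`-tuples of points, defined over `k` by the nonvanishing of a polynomial `f`
in the homogeneous coordinates, such that `P` holds for all tuples in it with coordinates in any
extension field of `k`. (Extension fields matter if `k` is finite, as the open set may then have
no points over `k`.) -/
def HoldsForGeneralPoints (k : Type u) [Field k] (r γ : ℕ)
    (P : ∀ (K : Type u) [Field K], (Fin γ → ℙ K (Fin (r + 1) → K)) → Prop) : Prop :=
  ∃ f : MvPolynomial (Fin γ × Fin (r + 1)) k, f ≠ 0 ∧
    ∀ (K : Type u) [Field K] [Algebra k K] (v : Fin γ → Fin (r + 1) → K) (hv : ∀ i, v i ≠ 0),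
      MvPolynomial.aeval (fun x : Fin γ × Fin (r + 1) => v x.1 x.2) f ≠ 0 →
        P K (fun i => Projectivization.mk K (v i) (hv i))

/-- The Minimal Resolution Conjecture fails for a general set of `γ` points of `ℙ^r` over `k`. -/
def MRCFails (k : Type u) [Field k] (r γ : ℕ) : Prop :=
  HoldsForGeneralPoints k r γ fun _ _ p => ¬ SatisfiesMRC p

end PointsMRC

/-! Put s = γ - r - 2 and i = r - s. The conjecture fails at β_{i,i+2}. For points in linearly
general position this number is at least the dimension of the space of forms of degree s in y
variables, as soon as y + C(s+2,2) ≤ γ. In the main range s(s+1) ≤ 2r allows y = 1, so the bound is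
1, while r + 2 ≤ s² makes the expected value 0. In the two sporadic cases the bound still exceeds a
positive expected value.

Let V be the space of linear forms. Then β_{i,i+2} is the dimension of the Koszul cohomology of S/I
at alternating (s+1)-forms on V with values in (S/I)_2. Evaluation at the points identifies (S/I)_2
with K^γ, because γ ≤ 2r + 1, and (S/I)_1 = V with the orthogonal complement of the
(s+1)-dimensional space W of linear relations among the points (the Gale transform). The Koszul
complex with values in K^γ is exact, so the cohomology is the space of K^γ-valued s-cochains modulo
coboundaries and V-valued cochains.

This quotient is large for the following reason. A vector u orthogonal to all products ww' of
relations multiplies W into W^⊥ = V. Such a u yields a functional on s-cochains, `galeFunctional`,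
that kills both subspaces. When u varies in a space of dimension y, the functional takes values in
forms of degree s in y variables. Its image contains all products of s distinct coordinates of u,
and these span all forms of degree s (`LinearlyGeneral.exists_functional`).

Betti numbers are read off a resolution, so the classes are transported along it by connecting maps
through the syzygies. Each map raises the cochain degree by one and is injective below the top
degree, where the Koszul complex of a free module is exact (`MinimalFreeResolution.Lifts.succ`). In
the top degree the constant coefficients detect the classes
(`MinimalFreeResolution.Lifts.finrank_le`). -/

namespace PointsMRC

open AlternatingMap (alternatizeUncurryFinLM alternatizeUncurryFin_apply
  alternatizeUncurryFin_alternatizeUncurryFinLM_comp_of_symmetric)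

/-! ### The Koszul complex of alternating maps -/

section Koszul

variable {R V M N : Type*} [CommRing R] [AddCommGroup V] [Module R V]
  [AddCommGroup M] [Module R M] [AddCommGroup N] [Module R N]

/-- The Koszul differential on alternating maps with values in a module `M`
on which the vectors of `V` act by linear endomorphisms. -/
def koszul (A : V →ₗ[R] M →ₗ[R] M) (q : ℕ) :
    (V [⋀^Fin q]→ₗ[R] M) →ₗ[R] (V [⋀^Fin (q + 1)]→ₗ[R] M) :=
  alternatizeUncurryFinLM ∘ₗ
    LinearMap.mk₂ R (fun φ v => (A v).compAlternatingMap φ)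
      (fun _ _ _ => by ext; simp) (fun _ _ _ => by ext; simp)
      (fun _ _ _ => by ext; simp) (fun _ _ _ => by ext; simp)

theorem koszul_apply (A : V →ₗ[R] M →ₗ[R] M) (q : ℕ) (φ : V [⋀^Fin q]→ₗ[R] M)
    (v : Fin (q + 1) → V) :
    koszul A q φ v = ∑ i : Fin (q + 1), (-1) ^ (i : ℕ) • A (v i) (φ (i.removeNth v)) := by
  simp [koszul, alternatizeUncurryFin_apply]

theorem koszul_koszul (A : V →ₗ[R] M →ₗ[R] M) (hA : ∀ v w x, A v (A w x) = A w (A v x))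
    (q : ℕ) (φ : V [⋀^Fin q]→ₗ[R] M) : koszul A (q + 1) (koszul A q φ) = 0 := by
  have h := alternatizeUncurryFin_alternatizeUncurryFinLM_comp_of_symmetric
    (f := LinearMap.mk₂ R (fun v w => (A v ∘ₗ A w).compAlternatingMap φ)
      (fun _ _ _ => by ext; simp) (fun _ _ _ => by ext; simp)
      (fun _ _ _ => by ext; simp) (fun _ _ _ => by ext; simp))
    (fun v w => by ext m; simp [hA v w])
  rw [← h]
  ext v
  simp [koszul_apply, alternatizeUncurryFin_apply]

theorem koszul_compAlternatingMap {A : V →ₗ[R] M →ₗ[R] M} {B : V →ₗ[R] N →ₗ[R] N}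
    (f : M →ₗ[R] N) (hf : ∀ v x, f (A v x) = B v (f x)) (q : ℕ) (φ : V [⋀^Fin q]→ₗ[R] M) :
    koszul B q (f.compAlternatingMap φ) = f.compAlternatingMap (koszul A q φ) := by
  ext v
  simp [koszul_apply, hf]

/-- Cartan's formula: contraction with `v` is a homotopy between multiplication by `v` and zero. -/
theorem koszul_curryLeft_add (A : V →ₗ[R] M →ₗ[R] M) (q : ℕ) (φ : V [⋀^Fin (q + 1)]→ₗ[R] M)
    (v : V) :
    koszul A q (φ.curryLeft v) + (koszul A (q + 1) φ).curryLeft v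
      = (A v).compAlternatingMap φ := by
  ext m
  have h : ∀ i : Fin (q + 1),
      (i.succ).removeNth (Matrix.vecCons v m) = Matrix.vecCons v (i.removeNth m) := by
    intro i
    ext j
    refine Fin.cases ?_ (fun j => ?_) j <;> simp [Fin.removeNth]
  have h0 : (0 : Fin (q + 2)).removeNth (Matrix.vecCons v m) = m := by
    ext j; simp [Fin.removeNth]
  simp only [AlternatingMap.add_apply, koszul_apply, AlternatingMap.curryLeft_apply_apply,
    LinearMap.compAlternatingMap_apply]
  rw [Fin.sum_univ_succ (n := q + 1)]
  simp [h, h0, pow_succ]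

theorem koszul_curryLeft_of_closed (A : V →ₗ[R] M →ₗ[R] M) (q : ℕ)
    (φ : V [⋀^Fin (q + 1)]→ₗ[R] M) (hφ : koszul A (q + 1) φ = 0) (v : V) :
    koszul A q (φ.curryLeft v) = (A v).compAlternatingMap φ := by
  rw [← koszul_curryLeft_add, hφ]
  ext; simp

/-- Vanishing of the Koszul cohomology in degrees below `D`. -/
def KoszulAcyclic (A : V →ₗ[R] M →ₗ[R] M) (D : ℕ) : Prop :=
  (0 < D → ∀ φ : V [⋀^Fin 0]→ₗ[R] M, koszul A 0 φ = 0 → φ = 0) ∧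
  ∀ q, q + 1 < D → ∀ φ : V [⋀^Fin (q + 1)]→ₗ[R] M, koszul A (q + 1) φ = 0 →
    ∃ ψ, koszul A q ψ = φ

end Koszul

/-! ### Exactness of the Koszul complex of a polynomial ring below the top degree -/

section KoszulField

variable {K V M N : Type*} [Field K] [AddCommGroup V] [Module K V]
  [AddCommGroup M] [Module K M] [AddCommGroup N] [Module K N]

/-- Here N = M/vM with `v` a nonzerodivisor on M. For closed φ, the contraction with `v` has
differential vφ, so it is closed modulo `v`, hence exact there, and equals a closed cochain plus vθ.
Applying the differential gives vφ = v dθ, and `v` cancels. -/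
theorem KoszulAcyclic.of_quotient {A : V →ₗ[K] M →ₗ[K] M} {B : V →ₗ[K] N →ₗ[K] N}
    (hA : ∀ v w x, A v (A w x) = A w (A v x))
    (f : M →ₗ[K] N) (hf : ∀ v x, f (A v x) = B v (f x)) (hsurj : Function.Surjective f)
    (v : V) (hinj : Function.Injective (A v)) (hker : ∀ x, f x = 0 → ∃ y, A v y = x)
    (hfv : ∀ x, f (A v x) = 0) {D : ℕ} (hB : KoszulAcyclic B D) : KoszulAcyclic A (D + 1) := by
  obtain ⟨σ, hσ⟩ := f.exists_rightInverse_of_surjective (LinearMap.range_eq_top.2 hsurj)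
  obtain ⟨τ, hτ⟩ := (A v).exists_leftInverse_of_injective (LinearMap.ker_eq_bot.2 hinj)
  have hσ' : ∀ x, f (σ x) = x := fun x => LinearMap.congr_fun hσ x
  have hτ' : ∀ x, f x = 0 → A v (τ x) = x := by
    intro x hx
    obtain ⟨y, rfl⟩ := hker x hx
    rw [show τ (A v y) = y from LinearMap.congr_fun hτ y]
  constructor
  · intro _ φ hφ
    ext m
    apply hinj
    have := DFunLike.congr_fun hφ (fun _ => v)
    rw [koszul_apply] at this
    simpa [Subsingleton.elim m (Fin.removeNth 0 fun _ => v)] using this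
  · intro q hq φ hφ
    have h1 := koszul_curryLeft_of_closed A q φ hφ v
    have h2 : koszul B q (f.compAlternatingMap (φ.curryLeft v)) = 0 := by
      rw [koszul_compAlternatingMap f hf, h1]
      ext m
      simp [hfv]
    have key : ∃ θ : V [⋀^Fin q]→ₗ[K] M, ∃ χ : V [⋀^Fin q]→ₗ[K] M, koszul A q χ = 0 ∧
        φ.curryLeft v = χ + (A v).compAlternatingMap θ := by
      rcases q with _ | q
      · have h3 := hB.1 (by lia) _ h2
        refine ⟨τ.compAlternatingMap (φ.curryLeft v), 0, by simp, ?_⟩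
        ext m
        simp only [zero_add, LinearMap.compAlternatingMap_apply]
        rw [hτ']
        exact DFunLike.congr_fun h3 m
      · obtain ⟨ψ, hψ⟩ := hB.2 q (by lia) _ h2
        refine ⟨τ.compAlternatingMap (φ.curryLeft v - koszul A q (σ.compAlternatingMap ψ)),
          koszul A q (σ.compAlternatingMap ψ), koszul_koszul A hA _ _, ?_⟩
        ext m
        simp only [AlternatingMap.add_apply, LinearMap.compAlternatingMap_apply]
        rw [hτ', AlternatingMap.sub_apply]
        · abel
        · have h4 : f.compAlternatingMap (koszul A q (σ.compAlternatingMap ψ))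
              = f.compAlternatingMap (φ.curryLeft v) := by
            rw [← hψ, ← koszul_compAlternatingMap f hf]
            congr 1
            ext m
            simp [hσ']
          have := DFunLike.congr_fun h4 m
          simp only [LinearMap.compAlternatingMap_apply] at this
          rw [AlternatingMap.sub_apply, map_sub, this, sub_self]
    obtain ⟨θ, χ, hχ, h⟩ := key
    refine ⟨θ, ?_⟩
    rw [h, map_add, hχ, zero_add, koszul_compAlternatingMap (A := A) (A v) (fun w x => hA v w x)]
      at h1
    ext m
    exact hinj (DFunLike.congr_fun h1 m)

/-- The action of `V` on polynomials through linear forms. -/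
noncomputable def formAction {m : ℕ} (c : V →ₗ[K] (Fin m → K)) :
    V →ₗ[K] MvPolynomial (Fin m) K →ₗ[K] MvPolynomial (Fin m) K :=
  (LinearMap.mul K (MvPolynomial (Fin m) K)) ∘ₗ
    (Fintype.linearCombination K (MvPolynomial.X : Fin m → MvPolynomial (Fin m) K)) ∘ₗ c

theorem formAction_apply {m : ℕ} (c : V →ₗ[K] (Fin m → K)) (v : V) (P : MvPolynomial (Fin m) K) :
    formAction c v P = (∑ i, c v i • MvPolynomial.X i) * P := by
  simp [formAction, Fintype.linearCombination_apply, Finset.sum_mul]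

theorem formAction_comm {m : ℕ} (c : V →ₗ[K] (Fin m → K)) (v w : V)
    (P : MvPolynomial (Fin m) K) :
    formAction c v (formAction c w P) = formAction c w (formAction c v P) := by
  simp only [formAction_apply]; ring

open MvPolynomial in
theorem exists_X_zero_mul_of_aeval_eq_zero {m : ℕ} (P : MvPolynomial (Fin (m + 1)) K)
    (hP : aeval (Fin.cases 0 X : Fin (m + 1) → MvPolynomial (Fin m) K) P = 0) :
    ∃ Q, X 0 * Q = P := by
  let J : Ideal (MvPolynomial (Fin (m + 1)) K) := Ideal.span {X 0}
  have h : Ideal.Quotient.mkₐ K J = ((Ideal.Quotient.mkₐ K J).comp (rename Fin.succ)).comp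
      (aeval (Fin.cases 0 X : Fin (m + 1) → MvPolynomial (Fin m) K)) := by
    apply MvPolynomial.algHom_ext
    intro i
    refine Fin.cases ?_ (fun i => ?_) i
    · simp only [AlgHom.comp_apply, aeval_X, Fin.cases_zero, map_zero]
      exact Ideal.Quotient.eq_zero_iff_mem.2 (Ideal.mem_span_singleton_self _)
    · simp
  have h2 := DFunLike.congr_fun h P
  rw [AlgHom.comp_apply, hP, map_zero] at h2
  have h3 : P ∈ J := Ideal.Quotient.eq_zero_iff_mem.1 h2
  obtain ⟨Q, hQ⟩ := Ideal.mem_span_singleton.1 h3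
  exact ⟨Q, hQ.symm⟩

/-- Induction by killing one variable at a time. The space V stays fixed while the ring shrinks,
which is why V acts through a surjection `c` instead of being the space of linear forms itself. -/
theorem koszulAcyclic_formAction (m : ℕ) :
    ∀ c : V →ₗ[K] (Fin m → K), Function.Surjective c → KoszulAcyclic (formAction c) m := by
  induction m with
  | zero => exact fun c _ => ⟨fun h => absurd h (lt_irrefl _), fun q h => absurd h (by lia)⟩
  | succ m ih =>
    intro c hc
    let c' : V →ₗ[K] (Fin m → K) := LinearMap.funLeft K K Fin.succ ∘ₗ c
    have hc' : Function.Surjective c' := by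
      intro x
      obtain ⟨v, hv⟩ := hc (Fin.cons 0 x)
      exact ⟨v, by ext i; simp [c', hv, LinearMap.funLeft_apply]⟩
    obtain ⟨v, hv⟩ := hc (Pi.single 0 1)
    have hAv : ∀ P, formAction c v P = MvPolynomial.X 0 * P := by
      intro P
      rw [formAction_apply, hv, Finset.sum_eq_single 0] <;> simp +contextual
    let f := MvPolynomial.aeval (R := K)
      (Fin.cases 0 MvPolynomial.X : Fin (m + 1) → MvPolynomial (Fin m) K)
    refine KoszulAcyclic.of_quotient (formAction_comm c) f.toLinearMap ?_ ?_ v ?_ ?_ ?_ (ih c' hc')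
    · intro w P
      simp [formAction_apply, f, c', Fin.sum_univ_succ, LinearMap.funLeft_apply]
    · intro P
      refine ⟨MvPolynomial.rename Fin.succ P, ?_⟩
      have : f.comp (MvPolynomial.rename Fin.succ) = AlgHom.id K _ := by
        apply MvPolynomial.algHom_ext
        intro i
        simp [f]
      exact DFunLike.congr_fun this P
    · intro P Q h
      rw [hAv, hAv] at h
      exact mul_left_cancel₀ (MvPolynomial.X_ne_zero _) h
    · intro P hP
      obtain ⟨Q, hQ⟩ := exists_X_zero_mul_of_aeval_eq_zero P hP
      exact ⟨Q, by rw [hAv, hQ]⟩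
    · intro P
      rw [hAv]
      simp [f]

end KoszulField

/-! ### Graded components with shifted degrees -/

section Graded

variable {K σ : Type*} [Field K]

open MvPolynomial

/-- The component of degree `j` of a polynomial, where the degrees are shifted by `c`. -/
noncomputable def shiftedComponent (c j : ℕ) : MvPolynomial σ K →ₗ[K] MvPolynomial σ K :=
  -- Without the test, truncated subtraction would return the constant term when `j < c`.
  if c ≤ j then homogeneousComponent (j - c) else 0

theorem coeff_shiftedComponent (c j : ℕ) (m : σ →₀ ℕ) (P : MvPolynomial σ K) :
    coeff m (shiftedComponent c j P) = if m.degree + c = j then coeff m P else 0 := by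
  classical
  unfold shiftedComponent
  split_ifs with h h1 h1
  · rw [coeff_homogeneousComponent, if_pos (by lia)]
  · rw [coeff_homogeneousComponent, if_neg (by lia)]
  · lia
  · simp

theorem shiftedComponent_shiftedComponent (c j : ℕ) (P : MvPolynomial σ K) :
    shiftedComponent c j (shiftedComponent c j P) = shiftedComponent c j P := by
  ext m
  simp only [coeff_shiftedComponent]
  split_ifs <;> rfl

theorem shiftedComponent_mul {b a : ℕ} (G : MvPolynomial σ K)
    (hG : ∀ m ∈ G.support, m.degree + b = a) (j : ℕ) (P : MvPolynomial σ K) :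
    shiftedComponent b j (G * P) = G * shiftedComponent a j P := by
  classical
  ext m
  rw [coeff_shiftedComponent, coeff_mul, coeff_mul]
  have : ∀ x ∈ Finset.HasAntidiagonal.antidiagonal m, coeff x.1 G * coeff x.2 (shiftedComponent a j P)
      = if m.degree + b = j then coeff x.1 G * coeff x.2 P else 0 := by
    intro x hx
    rw [Finset.HasAntidiagonal.mem_antidiagonal] at hx
    by_cases h0 : coeff x.1 G = 0
    · simp [h0]
    · have h1 := hG x.1 (mem_support_iff.2 h0)
      have h2 : m.degree = x.1.degree + x.2.degree := by rw [← hx, map_add]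
      rw [coeff_shiftedComponent]
      by_cases h : m.degree + b = j
      · rw [if_pos h, if_pos (by lia)]
      · rw [if_neg h, if_neg (by lia), mul_zero]
  rw [Finset.sum_congr rfl this]
  split_ifs <;> simp

theorem shiftedComponent_succ (c j : ℕ) :
    (shiftedComponent (c + 1) (j + 1) : MvPolynomial σ K →ₗ[K] MvPolynomial σ K)
      = shiftedComponent c j := by
  unfold shiftedComponent
  simp

theorem shiftedComponent_of_isHomogeneous {j : ℕ} {P : MvPolynomial σ K} (hP : P.IsHomogeneous j) :
    shiftedComponent 0 j P = P := by
  simp [shiftedComponent, homogeneousComponent_of_mem hP]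

theorem isHomogeneous_shiftedComponent (j : ℕ) (P : MvPolynomial σ K) :
    (shiftedComponent 0 j P).IsHomogeneous j := by
  simpa [shiftedComponent] using homogeneousComponent_isHomogeneous j P

/-- The component of degree `j` of an element of a graded free module with basis vectors of
degrees `deg a`. -/
noncomputable def freeComponent {ρ : Type*} (deg : ρ → ℕ) (j : ℕ) :
    (ρ → MvPolynomial σ K) →ₗ[K] (ρ → MvPolynomial σ K) :=
  LinearMap.pi fun a => shiftedComponent (deg a) j ∘ₗ LinearMap.proj a

theorem freeComponent_apply {ρ : Type*} (deg : ρ → ℕ) (j : ℕ) (f : ρ → MvPolynomial σ K) (a : ρ) :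
    freeComponent deg j f a = shiftedComponent (deg a) j (f a) := rfl

theorem freeComponent_freeComponent {ρ : Type*} (deg : ρ → ℕ) (j : ℕ) (f : ρ → MvPolynomial σ K) :
    freeComponent deg j (freeComponent deg j f) = freeComponent deg j f := by
  ext1 a
  simp only [freeComponent_apply, shiftedComponent_shiftedComponent]

theorem freeComponent_mulVec {ρ ρ' : Type*} [Fintype ρ'] (deg : ρ → ℕ) (deg' : ρ' → ℕ)
    (D : Matrix ρ ρ' (MvPolynomial σ K))
    (hD : ∀ b a, ∀ m ∈ (D b a).support, m.degree + deg b = deg' a) (j : ℕ)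
    (f : ρ' → MvPolynomial σ K) :
    freeComponent deg j (D.mulVec f) = D.mulVec (freeComponent deg' j f) := by
  ext1 b
  simp only [freeComponent_apply, Matrix.mulVec, dotProduct, map_sum]
  exact Finset.sum_congr rfl fun a _ => shiftedComponent_mul _ (hD b a) j _

end Graded

/-! ### Koszul cochains with values in free modules -/

section Actions

variable {K : Type*} [Field K]

/-- Preimages are chosen linearly, so that cochains lifted value by value remain multilinear and
depend linearly on parameters. -/
theorem exists_partial_rightInverse {M N : Type*} [AddCommGroup M] [Module K M] [AddCommGroup N]
    [Module K N] (f : M →ₗ[K] N) : ∃ g : N →ₗ[K] M, ∀ x, f (g (f x)) = f x := by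
  obtain ⟨g, hg⟩ := f.rangeRestrict.exists_rightInverse_of_surjective f.range_rangeRestrict
  obtain ⟨g', hg'⟩ := LinearMap.exists_extend g
  refine ⟨g', fun x => ?_⟩
  have h1 : g' (f x) = g (f.rangeRestrict x) := by rw [← hg']; rfl
  have h2 := congrArg Subtype.val (LinearMap.congr_fun hg (f.rangeRestrict x))
  rw [h1]
  exact h2

theorem alternatingMap_sum_apply {V N ι α : Type*} [AddCommGroup V] [Module K V] [AddCommGroup N]
    [Module K N] (t : Finset α) (f : α → V [⋀^ι]→ₗ[K] N) (v : ι → V) :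
    (∑ i ∈ t, f i) v = ∑ i ∈ t, f i v := by
  classical
  induction t using Finset.induction_on with
  | empty => simp
  | insert a t ha ih => simp [Finset.sum_insert ha, ih]

/-- The linear form with given coefficients. -/
noncomputable def linForm (K : Type*) [Field K] (n : ℕ) :
    (Fin n → K) →ₗ[K] MvPolynomial (Fin n) K :=
  Fintype.linearCombination K MvPolynomial.X

theorem linForm_apply {n : ℕ} (v : Fin n → K) :
    linForm K n v = ∑ i, v i • MvPolynomial.X i := by
  simp [linForm, Fintype.linearCombination_apply]

theorem linForm_single {n : ℕ} (i : Fin n) :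
    linForm K n (Pi.single i 1) = MvPolynomial.X i := by
  simp [linForm]

theorem isHomogeneous_linForm {n : ℕ} (v : Fin n → K) : (linForm K n v).IsHomogeneous 1 := by
  rw [linForm_apply]
  refine MvPolynomial.IsHomogeneous.sum _ _ _ fun i _ => ?_
  rw [MvPolynomial.smul_eq_C_mul]
  simpa using (MvPolynomial.isHomogeneous_C _ _).mul (MvPolynomial.isHomogeneous_X K i)

theorem shiftedComponent_linForm_mul {n : ℕ} (c j : ℕ) (v : Fin n → K)
    (P : MvPolynomial (Fin n) K) :
    shiftedComponent c (j + 1) (linForm K n v * P) = linForm K n v * shiftedComponent c j P := by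
  rw [shiftedComponent_mul (a := c + 1), shiftedComponent_succ]
  intro m hm
  have := isHomogeneous_linForm v (MvPolynomial.mem_support_iff.1 hm)
  have h1 : m.degree = 1 := by rw [Finsupp.degree_eq_weight_one]; exact this
  lia

/-- The action of vectors on a module over the polynomial ring through linear forms. -/
noncomputable def moduleAction (n : ℕ) (M : Type*) [AddCommGroup M] [Module K M]
    [Module (MvPolynomial (Fin n) K) M] [IsScalarTower K (MvPolynomial (Fin n) K) M] :
    (Fin n → K) →ₗ[K] M →ₗ[K] M :=
  (Algebra.lsmul K K M).toLinearMap ∘ₗ linForm K n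

theorem moduleAction_apply {n : ℕ} {M : Type*} [AddCommGroup M] [Module K M]
    [Module (MvPolynomial (Fin n) K) M] [IsScalarTower K (MvPolynomial (Fin n) K) M]
    (v : Fin n → K) (x : M) : moduleAction n M v x = linForm K n v • x := rfl

theorem moduleAction_comm {n : ℕ} {M : Type*} [AddCommGroup M] [Module K M]
    [Module (MvPolynomial (Fin n) K) M] [IsScalarTower K (MvPolynomial (Fin n) K) M]
    (v w : Fin n → K) (x : M) :
    moduleAction n M v (moduleAction n M w x) = moduleAction n M w (moduleAction n M v x) := by
  simp only [moduleAction_apply]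
  exact smul_comm _ _ _

theorem exists_koszul_eq_free {n : ℕ} (ρ : Type*) (q : ℕ) (hq : q + 1 < n)
    (φ : (Fin n → K) [⋀^Fin (q + 1)]→ₗ[K] (ρ → MvPolynomial (Fin n) K))
    (hφ : koszul (moduleAction n _) (q + 1) φ = 0) :
    ∃ ψ, koszul (moduleAction n _) q ψ = φ := by
  have key : ∀ a : ρ, ∃ ψ, koszul (formAction (LinearMap.id : (Fin n → K) →ₗ[K] _)) q ψ
      = (LinearMap.proj (R := K) (φ := fun _ : ρ => MvPolynomial (Fin n) K) a).compAlternatingMap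
        φ := by
    intro a
    have hac := koszulAcyclic_formAction n (LinearMap.id : (Fin n → K) →ₗ[K] (Fin n → K))
      (fun x => ⟨x, rfl⟩)
    refine hac.2 q hq _ ?_
    have h := koszul_compAlternatingMap (A := moduleAction n (ρ → MvPolynomial (Fin n) K))
      (B := formAction (LinearMap.id : (Fin n → K) →ₗ[K] _))
      (LinearMap.proj (R := K) (φ := fun _ : ρ => MvPolynomial (Fin n) K) a)
      (fun v x => by rw [formAction_apply, moduleAction_apply, linForm_apply]; rfl) (q + 1) φ
    rw [h, hφ, LinearMap.compAlternatingMap_zero]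
  choose ψ hψ using key
  refine ⟨AlternatingMap.pi ψ, ?_⟩
  ext1 m
  funext a
  have := DFunLike.congr_fun (hψ a) m
  rw [LinearMap.compAlternatingMap_apply, LinearMap.proj_apply] at this
  rw [← this, koszul_apply, koszul_apply, Finset.sum_apply]
  refine Finset.sum_congr rfl fun i _ => ?_
  rw [formAction_apply, moduleAction_apply, linForm_apply]
  rfl

open MvPolynomial in
theorem exists_sum_X_mul_of_constantCoeff_eq_zero {n : ℕ} (P : MvPolynomial (Fin n) K)
    (hP : constantCoeff P = 0) : ∃ g : Fin n → MvPolynomial (Fin n) K, ∑ i, X i * g i = P := by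
  have h : P ∈ Ideal.span (Set.range (X : Fin n → MvPolynomial (Fin n) K)) := by
    rw [← Set.image_univ, mem_ideal_span_X_image]
    intro m hm
    by_contra! h0
    have : m = 0 := by ext i; simpa using h0 i (Set.mem_univ _)
    subst this
    exact mem_support_iff.1 hm hP
  obtain ⟨c, hc⟩ := Ideal.mem_span_range_iff_exists_fun.1 h
  exact ⟨c, by rw [← hc]; exact Finset.sum_congr rfl fun i _ => mul_comm _ _⟩

/-- A top degree cochain with values in the maximal ideal times a free module is a coboundary. -/
theorem exists_koszul_eq_top {n : ℕ} (ρ : Type*)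
    (φ : (Fin (n + 1) → K) [⋀^Fin (n + 1)]→ₗ[K] (ρ → MvPolynomial (Fin (n + 1)) K))
    (hφ : ∀ v a, MvPolynomial.constantCoeff (φ v a) = 0) :
    ∃ ψ, koszul (moduleAction (n + 1) _) n ψ = φ := by
  -- `Q` sends (f_c) to ∑ x_c f_c. Its partial inverse writes φ as ∑ x_c ψ_c with each ψ_c
  -- alternating. Every ψ_c is closed for lack of nonzero forms of higher degree, so by Cartan's
  -- formula x_c ψ_c is the differential of the contraction of ψ_c with the c-th basis vector.
  let Q : (Fin (n + 1) → ρ → MvPolynomial (Fin (n + 1)) K) →ₗ[K]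
      (ρ → MvPolynomial (Fin (n + 1)) K) :=
    ∑ c, moduleAction (n + 1) (ρ → MvPolynomial (Fin (n + 1)) K) (Pi.single c 1) ∘ₗ
      LinearMap.proj c
  obtain ⟨g, hg⟩ := exists_partial_rightInverse Q
  have hQ : ∀ v, Q (g (φ v)) = φ v := by
    intro v
    choose h hh using fun a => exists_sum_X_mul_of_constantCoeff_eq_zero _ (hφ v a)
    have : φ v = Q (fun c a => h a c) := by
      funext a
      rw [← hh a]
      simp [Q, moduleAction_apply, linForm_single, LinearMap.sum_apply, Finset.sum_apply]
    rw [this, hg]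
  let ψ : Fin (n + 1) → (Fin (n + 1) → K) [⋀^Fin (n + 1)]→ₗ[K] (ρ → MvPolynomial (Fin (n + 1)) K) :=
    fun c => (LinearMap.proj c ∘ₗ g).compAlternatingMap φ
  refine ⟨∑ c, (ψ c).curryLeft (Pi.single c 1), ?_⟩
  rw [map_sum]
  have h1 : ∀ c, koszul (moduleAction (n + 1) _) n ((ψ c).curryLeft (Pi.single c 1))
      = (moduleAction (n + 1) _ (Pi.single c 1)).compAlternatingMap (ψ c) := by
    intro c
    apply koszul_curryLeft_of_closed
    refine Module.Basis.ext_alternating (Pi.basisFun K (Fin (n + 1))) fun κ hκ => ?_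
    exact absurd (Fintype.card_le_of_injective κ hκ) (by simp)
  rw [Finset.sum_congr rfl fun c _ => h1 c]
  ext1 v
  conv_rhs => rw [← hQ v]
  simp [Q, ψ, LinearMap.sum_apply, alternatingMap_sum_apply]

end Actions

/-! ### Transport of Koszul classes along a free resolution -/

section Zigzag

variable {K : Type u} [Field K] {r : ℕ} {I : Ideal (CoordRing K r)}

/-- The differential of a resolution as a linear map over the base field. -/
noncomputable def MinimalFreeResolution.diff (F : MinimalFreeResolution I) (p : ℕ) :
    (Fin (F.rank (p + 1)) → CoordRing K r) →ₗ[K] (Fin (F.rank p) → CoordRing K r) :=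
  (F.d p).mulVecLin.restrictScalars K

theorem MinimalFreeResolution.diff_apply (F : MinimalFreeResolution I) (p : ℕ) (f) :
    F.diff p f = (F.d p).mulVec f := rfl

theorem MinimalFreeResolution.diff_moduleAction (F : MinimalFreeResolution I) (p : ℕ)
    (v : Fin (r + 1) → K) (f) :
    F.diff p (moduleAction (r + 1) _ v f) = moduleAction (r + 1) _ v (F.diff p f) := by
  rw [moduleAction_apply, moduleAction_apply, F.diff_apply, F.diff_apply, Matrix.mulVec_smul]

theorem MinimalFreeResolution.freeComponent_diff (F : MinimalFreeResolution I) (p j : ℕ) (f) :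
    freeComponent (F.deg p) j (F.diff p f) = F.diff p (freeComponent (F.deg (p + 1)) j f) :=
  freeComponent_mulVec _ _ _ (F.d_homogeneous p) j f

theorem freeComponent_moduleAction {ρ : Type*} (deg : ρ → ℕ) (j : ℕ) (v : Fin (r + 1) → K)
    (f : ρ → CoordRing K r) :
    freeComponent deg (j + 1) (moduleAction (r + 1) _ v f)
      = moduleAction (r + 1) _ v (freeComponent deg j f) := by
  funext a
  rw [freeComponent_apply, moduleAction_apply, moduleAction_apply, Pi.smul_apply, smul_eq_mul,
    shiftedComponent_linForm_mul, Pi.smul_apply, smul_eq_mul, freeComponent_apply]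

theorem freeComponent_koszul {ρ : Type*} (deg : ρ → ℕ) (j q : ℕ)
    (φ : (Fin (r + 1) → K) [⋀^Fin q]→ₗ[K] (ρ → CoordRing K r))
    (hφ : ∀ v, freeComponent deg j (φ v) = φ v) (v : Fin (q + 1) → Fin (r + 1) → K) :
    freeComponent deg (j + 1) (koszul (moduleAction (r + 1) _) q φ v)
      = koszul (moduleAction (r + 1) _) q φ v := by
  rw [koszul_apply, map_sum]
  refine Finset.sum_congr rfl fun i _ => ?_
  rw [map_zsmul, freeComponent_moduleAction, hφ]

theorem MinimalFreeResolution.diff_diff (F : MinimalFreeResolution I) (p : ℕ) (f) :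
    F.diff p (F.diff (p + 1) f) = 0 :=
  (F.exact_succ p _).2 ⟨f, rfl⟩

theorem MinimalFreeResolution.mem_range_diff (F : MinimalFreeResolution I) (p : ℕ) (f)
    (hf : F.diff p f = 0) : ∃ g, F.diff (p + 1) g = f :=
  (F.exact_succ p f).1 hf

/-- The data carried along the resolution by the comparison of the Koszul cohomology of `S/I`
with the resolution. -/
def MinimalFreeResolution.Lifts (F : MinimalFreeResolution I) (T : Type*) [AddCommGroup T]
    [Module K T] (s m p : ℕ) : Prop :=
  ∃ φ : T →ₗ[K] ((Fin (r + 1) → K) [⋀^Fin (s + p + 1)]→ₗ[K] (Fin (F.rank p) → CoordRing K r)),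
    (∀ t v, freeComponent (F.deg p) (m + p) (φ t v) = φ t v) ∧
    (∀ t v, ∃ g, F.diff p g = koszul (moduleAction (r + 1) _) (s + p + 1) (φ t) v) ∧
    ∀ t a b, φ t = koszul (moduleAction (r + 1) _) (s + p) a + (F.diff p).compAlternatingMap b →
      t = 0

/-- This is the connecting map to the next syzygy module: lift dφ through the differential of the
resolution. If the lift is trivial, then φ minus an element of the image is closed with values in a
free module, hence exact below the top degree, so φ was already trivial. -/
theorem MinimalFreeResolution.Lifts.succ {F : MinimalFreeResolution I} {T : Type*}
    [AddCommGroup T] [Module K T] {s m p : ℕ} (hp : s + p + 1 < r + 1) (h : F.Lifts T s m p) :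
    F.Lifts T s m (p + 1) := by
  obtain ⟨φ, hdeg, hcl, hnb⟩ := h
  obtain ⟨g, hg⟩ := exists_partial_rightInverse (F.diff p)
  -- The linear preimage `g` ignores degrees; projecting to the right degree still gives a preimage,
  -- since the differential is graded.
  let π := freeComponent (F.deg (p + 1)) (m + p + 1) (σ := Fin (r + 1)) (K := K)
  let w : T →ₗ[K] _ := LinearMap.compAlternatingMapₗ K (π ∘ₗ g) ∘ₗ
    koszul (moduleAction (r + 1) _) (s + p + 1) ∘ₗ φ
  have hw : ∀ t v, w t v = π (g (koszul (moduleAction (r + 1) _) (s + p + 1) (φ t) v)) :=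
    fun _ _ => rfl
  have hdw : ∀ t, (F.diff p).compAlternatingMap (w t)
      = koszul (moduleAction (r + 1) _) (s + p + 1) (φ t) := by
    intro t
    ext1 v
    rw [LinearMap.compAlternatingMap_apply, hw, ← F.freeComponent_diff]
    obtain ⟨x, hx⟩ := hcl t v
    rw [← hx, hg, hx]
    exact freeComponent_koszul _ _ _ _ (hdeg t) v
  refine ⟨w, fun t v => ?_, fun t v => ?_, fun t a b hab => ?_⟩
  · rw [hw]
    exact freeComponent_freeComponent _ _ _
  · apply F.mem_range_diff
    have h1 := koszul_compAlternatingMap (F.diff p) (F.diff_moduleAction p) _ (w t)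
    rw [hdw, koszul_koszul _ moduleAction_comm] at h1
    exact (DFunLike.congr_fun h1 v).symm
  · have h1 := hdw t
    rw [hab, LinearMap.compAlternatingMap_add,
      ← koszul_compAlternatingMap (F.diff p) (F.diff_moduleAction p)] at h1
    have h2 : (F.diff p).compAlternatingMap ((F.diff (p + 1)).compAlternatingMap b) = 0 := by
      ext1 v
      exact F.diff_diff p _
    rw [h2, add_zero] at h1
    obtain ⟨c, hc⟩ := exists_koszul_eq_free _ (s + p) hp
      (φ t - (F.diff p).compAlternatingMap a) (by rw [map_sub, ← h1]; exact sub_self _)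
    exact hnb t c a (by rw [hc]; abel)

/-- A top degree cochain is determined by its value on the standard basis. Constant terms can occur
only at basis vectors of degree `m + p`; if all of them vanish, `exists_koszul_eq_top` makes the
class trivial. So the constant terms embed `T`. -/
theorem MinimalFreeResolution.Lifts.finrank_le {F : MinimalFreeResolution I} {T : Type*}
    [AddCommGroup T] [Module K T] {s m p : ℕ} (hp : s + p = r) (h : F.Lifts T s m p) :
    Module.finrank K T ≤ F.betti p (m + p) := by
  subst hp
  obtain ⟨φ, hdeg, -, hnb⟩ := h
  let e : Fin (s + p + 1) → Fin (s + p + 1) → K := Pi.basisFun K (Fin (s + p + 1))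
  let cc : CoordRing K (s + p) →ₗ[K] K := MvPolynomial.lcoeff K 0
  let Φ : T →ₗ[K] ({a // F.deg p a = m + p} → K) :=
    { toFun := fun t a => cc (φ t e a)
      map_add' := fun x y => by funext a; simp
      map_smul' := fun c x => by funext a; simp }
  have hinj : Function.Injective Φ := by
    rw [← LinearMap.ker_eq_bot, LinearMap.ker_eq_bot']
    intro t ht
    have h1 : ∀ a, cc (φ t e a) = 0 := by
      intro a
      by_cases ha : F.deg p a = m + p
      · exact congrFun ht ⟨a, ha⟩
      · rw [← hdeg, freeComponent_apply]
        change MvPolynomial.coeff 0 _ = 0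
        rw [coeff_shiftedComponent, if_neg (by simpa using ha)]
    have h2 : ∀ v a, MvPolynomial.constantCoeff (φ t v a) = 0 := by
      intro v a
      have := ((cc ∘ₗ LinearMap.proj a).compAlternatingMap (φ t)).map_basis_eq_zero_iff
        (Pi.basisFun K (Fin (s + p + 1)))
      exact DFunLike.congr_fun (this.1 (h1 a)) v
    obtain ⟨ψ, hψ⟩ := exists_koszul_eq_top _ (φ t) h2
    exact hnb t ψ 0 (by rw [hψ]; simp)
  have := LinearMap.finrank_le_finrank_of_injective hinj
  simpa [MinimalFreeResolution.betti] using this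

/-- The zigzag starts by lifting through the augmentation. Homogeneity of `I` is what allows the
lift to be replaced by its component of degree `m`. -/
theorem MinimalFreeResolution.lifts_zero (F : MinimalFreeResolution I)
    (hI : ∀ P ∈ I, ∀ j, shiftedComponent 0 j P ∈ I) {T : Type*} [AddCommGroup T] [Module K T]
    {s m : ℕ} (φ : T →ₗ[K] ((Fin (r + 1) → K) [⋀^Fin (s + 1)]→ₗ[K] CoordRing K r))
    (hdeg : ∀ t v, (φ t v).IsHomogeneous m)
    (hcl : ∀ t v, koszul (moduleAction (r + 1) _) (s + 1) (φ t) v ∈ I)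
    (hnb : ∀ t ψ, (∀ v, φ t v - koszul (moduleAction (r + 1) _) s ψ v ∈ I) → t = 0) :
    F.Lifts T s m 0 := by
  let aug : (Fin (F.rank 0) → CoordRing K r) →ₗ[K] CoordRing K r ⧸ I := F.aug.restrictScalars K
  let mk : CoordRing K r →ₗ[K] CoordRing K r ⧸ I := (Ideal.Quotient.mkₐ K I).toLinearMap
  have haug : ∀ v f, aug (moduleAction (r + 1) _ v f) = moduleAction (r + 1) _ v (aug f) :=
    fun v f => F.aug.map_smul (linForm K (r + 1) v) f
  have hmk : ∀ (v : Fin (r + 1) → K) (f : CoordRing K r),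
      mk (moduleAction (r + 1) _ v f) = moduleAction (r + 1) _ v (mk f) := by
    intro v f
    exact (Submodule.mkQ I).map_smul (linForm K (r + 1) v) f
  have hmk0 : ∀ P, mk P = 0 ↔ P ∈ I := fun P => Ideal.Quotient.eq_zero_iff_mem
  choose G hGh hG using F.aug_homogeneous
  have haugG : ∀ f, aug f = mk (∑ a, G a * f a) := by
    intro f
    have h1 : f = ∑ a, f a • Pi.single a (1 : CoordRing K r) := by
      simpa using pi_eq_sum_univ' f
    change F.aug f = Ideal.Quotient.mk I _
    conv_lhs => rw [h1]
    rw [map_sum, map_sum]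
    refine Finset.sum_congr rfl fun a _ => ?_
    rw [map_smul, hG, mul_comm]
    rfl
  obtain ⟨g, hg⟩ := exists_partial_rightInverse aug
  have hg' : ∀ x, aug (g x) = x := by
    intro x
    obtain ⟨y, rfl⟩ := F.aug_surjective x
    exact hg y
  let π := freeComponent (F.deg 0) m (σ := Fin (r + 1)) (K := K)
  have hπ : ∀ P, P.IsHomogeneous m → aug (π (g (mk P))) = mk P := by
    intro P hP
    have h1 : mk (∑ a, G a * g (mk P) a - P) = 0 := by
      rw [map_sub, ← haugG, hg', sub_self]
    have h2 := hI _ ((hmk0 _).1 h1) m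
    rw [map_sub, shiftedComponent_of_isHomogeneous hP, ← hmk0, map_sub, sub_eq_zero, map_sum] at h2
    refine Eq.trans ?_ h2
    rw [haugG]
    congr 1
    refine Finset.sum_congr rfl fun a _ => ?_
    rw [shiftedComponent_mul (a := F.deg 0 a)]
    · rfl
    · intro d hd
      have := hGh a (MvPolynomial.mem_support_iff.1 hd)
      rw [add_zero, Finsupp.degree_eq_weight_one]
      exact this
  let w : T →ₗ[K] _ := LinearMap.compAlternatingMapₗ K (π ∘ₗ g ∘ₗ mk) ∘ₗ φ
  have hw : ∀ t, aug.compAlternatingMap (w t) = mk.compAlternatingMap (φ t) := by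
    intro t
    ext1 v
    exact hπ _ (hdeg t v)
  refine ⟨w, fun t v => freeComponent_freeComponent _ _ _, fun t v => ?_, fun t a b hab => ?_⟩
  · apply (F.exact_zero _).1
    have h1 := koszul_compAlternatingMap aug haug _ (w t)
    rw [hw, koszul_compAlternatingMap mk hmk] at h1
    have h2 := DFunLike.congr_fun h1 v
    rw [LinearMap.compAlternatingMap_apply, (hmk0 _).2 (hcl t v)] at h2
    exact h2.symm
  · obtain ⟨τ, hτ⟩ := exists_partial_rightInverse mk
    have hτ' : ∀ x, mk (τ x) = x := by
      intro x
      obtain ⟨y, rfl⟩ := Ideal.Quotient.mk_surjective x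
      exact hτ y
    have h1 := hw t
    have h2 : aug.compAlternatingMap ((F.diff 0).compAlternatingMap b) = 0 := by
      ext1 v
      exact (F.exact_zero _).2 ⟨b v, rfl⟩
    rw [hab, LinearMap.compAlternatingMap_add, h2, add_zero,
      ← koszul_compAlternatingMap aug haug] at h1
    refine hnb t (τ.compAlternatingMap (aug.compAlternatingMap a)) fun v => ?_
    rw [← hmk0, map_sub, sub_eq_zero]
    have h3 := koszul_compAlternatingMap mk hmk s (τ.compAlternatingMap (aug.compAlternatingMap a))
    have h4 : mk.compAlternatingMap (τ.compAlternatingMap (aug.compAlternatingMap a))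
        = aug.compAlternatingMap a := by
      ext1 v
      exact hτ' _
    rw [h4] at h3
    exact (DFunLike.congr_fun h1 v).symm.trans (DFunLike.congr_fun h3 v)

/-- A space of nontrivial Koszul cohomology classes of `S/I` bounds a graded Betti number
from below. -/
theorem MinimalFreeResolution.finrank_le_betti (F : MinimalFreeResolution I)
    (hI : ∀ P ∈ I, ∀ j, shiftedComponent 0 j P ∈ I) {T : Type*} [AddCommGroup T] [Module K T]
    {s m i : ℕ} (hsi : s + i = r)
    (φ : T →ₗ[K] ((Fin (r + 1) → K) [⋀^Fin (s + 1)]→ₗ[K] CoordRing K r))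
    (hdeg : ∀ t v, (φ t v).IsHomogeneous m)
    (hcl : ∀ t v, koszul (moduleAction (r + 1) _) (s + 1) (φ t) v ∈ I)
    (hnb : ∀ t ψ, (∀ v, φ t v - koszul (moduleAction (r + 1) _) s ψ v ∈ I) → t = 0) :
    Module.finrank K T ≤ F.betti i (m + i) := by
  have h : ∀ p, s + p ≤ r → F.Lifts T s m p := by
    intro p
    induction p with
    | zero => exact fun _ => F.lifts_zero hI φ hdeg hcl hnb
    | succ p ih => exact fun hp => (ih (by lia)).succ (by lia)
  exact (h i hsi.le).finrank_le hsi

end Zigzag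

/-! ### Points in linearly general position and their relations -/

section GeneralPosition

variable {K : Type*} [Field K] {n γ : ℕ}

/-- Any `n` of the vectors in `K^n` are linearly independent. -/
def LinearlyGeneral (P : Fin γ → Fin n → K) : Prop :=
  ∀ ι : Fin n → Fin γ, Function.Injective ι → LinearIndependent K (P ∘ ι)

theorem dual_apply_eq_dotProduct (f : Module.Dual K (Fin n → K)) (x : Fin n → K) :
    f x = (fun i => f (Pi.single i 1)) ⬝ᵥ x := by
  rw [LinearMap.pi_apply_eq_sum_univ f x]
  simp only [dotProduct, smul_eq_mul]
  refine Finset.sum_congr rfl fun i _ => ?_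
  rw [mul_comm]
  congr 2
  ext j
  simp [Pi.single_apply, eq_comm]

theorem LinearlyGeneral.span_eq_top {P : Fin γ → Fin n → K} (hP : LinearlyGeneral P)
    (J : Finset (Fin γ)) (hJ : n ≤ J.card) : Submodule.span K (P '' J) = ⊤ := by
  obtain ⟨J', hJ', hc⟩ := Finset.exists_subset_card_eq hJ
  have h1 := (hP (J'.orderEmbOfFin hc) (J'.orderEmbOfFin hc).injective).span_eq_top_of_card_eq_finrank'
    (by simp)
  rw [eq_top_iff, ← h1]
  apply Submodule.span_mono
  rintro _ ⟨i, rfl⟩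
  exact ⟨_, hJ' (J'.orderEmbOfFin_mem hc i), rfl⟩

theorem LinearlyGeneral.exists_form {P : Fin γ → Fin n → K} (hP : LinearlyGeneral P)
    (hγ : n ≤ γ) (J : Finset (Fin γ)) (hJ : J.card < n) {j₀ : Fin γ} (hj₀ : j₀ ∉ J) :
    ∃ v : Fin n → K, v ⬝ᵥ P j₀ = 1 ∧ ∀ j ∈ J, v ⬝ᵥ P j = 0 := by
  have hcard : (insert j₀ J).card ≤ n := by
    rw [Finset.card_insert_of_notMem hj₀]; lia
  obtain ⟨J', hJ', hc⟩ := Finset.exists_superset_card_eq hcard (by simpa using hγ)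
  have hli := hP (J'.orderEmbOfFin hc) (J'.orderEmbOfFin hc).injective
  have hmem : ∀ j ∈ J', ∃ i, J'.orderEmbOfFin hc i = j := by
    intro j hj
    have : j ∈ Set.range (J'.orderEmbOfFin hc) := by
      rw [Finset.range_orderEmbOfFin]; exact hj
    exact this
  obtain ⟨i₀, hi₀⟩ := hmem j₀ (hJ' (Finset.mem_insert_self _ _))
  have hnot : P j₀ ∉ Submodule.span K (P '' J) := by
    have h1 : i₀ ∉ {i | J'.orderEmbOfFin hc i ∈ J} := by simpa [hi₀] using hj₀
    have h2 := hli.notMem_span_image h1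
    rw [Function.comp_apply, hi₀] at h2
    refine fun h => h2 (Submodule.span_mono ?_ h)
    rintro _ ⟨j, hj, rfl⟩
    obtain ⟨i, rfl⟩ := hmem j (hJ' (Finset.mem_insert_of_mem hj))
    exact ⟨i, hj, rfl⟩
  obtain ⟨f, hf, hf0⟩ := Submodule.exists_dual_map_eq_bot_of_notMem hnot inferInstance
  refine ⟨(f (P j₀))⁻¹ • fun i => f (Pi.single i 1), ?_, fun j hj => ?_⟩
  · rw [smul_dotProduct, ← dual_apply_eq_dotProduct, smul_eq_mul, inv_mul_cancel₀ hf]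
  · rw [smul_dotProduct, ← dual_apply_eq_dotProduct]
    have : f (P j) ∈ (Submodule.span K (P '' J)).map f :=
      Submodule.mem_map_of_mem (Submodule.subset_span ⟨j, hj, rfl⟩)
    rw [hf0, Submodule.mem_bot] at this
    rw [this, smul_zero]

/-- The space of linear relations among the vectors, which defines the Gale transform. -/
noncomputable def relations (P : Fin γ → Fin n → K) : Submodule K (Fin γ → K) :=
  LinearMap.ker (Fintype.linearCombination K P)

theorem mem_relations {P : Fin γ → Fin n → K} {w : Fin γ → K} :
    w ∈ relations P ↔ ∑ j, w j • P j = 0 := by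
  rw [relations, LinearMap.mem_ker, Fintype.linearCombination_apply]

theorem sum_mul_dotProduct_of_mem_relations {P : Fin γ → Fin n → K} {w : Fin γ → K}
    (hw : w ∈ relations P) (v : Fin n → K) : ∑ j, w j * (v ⬝ᵥ P j) = 0 := by
  have h := congrArg (fun x => v ⬝ᵥ x) (mem_relations.1 hw)
  simpa [dotProduct_sum, dotProduct_smul] using h

theorem LinearlyGeneral.finrank_relations {P : Fin γ → Fin n → K} (hP : LinearlyGeneral P)
    {s : ℕ} (hγ : γ = n + s) : Module.finrank K (relations P) = s := by
  have h := (Fintype.linearCombination K P).finrank_range_add_finrank_ker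
  rw [Fintype.range_linearCombination, ← Set.image_univ, ← Finset.coe_univ,
    hP.span_eq_top _ (by simp; lia)] at h
  simp only [finrank_top, Module.finrank_fintype_fun_eq_card, Fintype.card_fin] at h
  change _ + Module.finrank K (relations P) = _ at h
  lia

/-- The points outside `J` still span, so `-P j₀` is a combination of them. This expresses general
position of the Gale transform. -/
theorem LinearlyGeneral.exists_relation {P : Fin γ → Fin n → K} (hP : LinearlyGeneral P)
    (J : Finset (Fin γ)) (hJ : n + J.card ≤ γ) (j₀ : Fin γ) (hj₀ : j₀ ∈ J) :
    ∃ w ∈ relations P, w j₀ = 1 ∧ ∀ j ∈ J, j ≠ j₀ → w j = 0 := by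
  classical
  have h : -P j₀ ∈ Submodule.span K (P '' (Jᶜ : Finset (Fin γ))) := by
    rw [hP.span_eq_top _ (by rw [Finset.card_compl, Fintype.card_fin]; lia)]
    trivial
  obtain ⟨c, hc⟩ : ∃ c : Fin γ → K, ∑ j ∈ Jᶜ, c j • P j = -P j₀ := by
    obtain ⟨c, hc⟩ := (Submodule.mem_span_image_finset_iff_exists_fun K).1 h
    refine ⟨fun j => if hj : j ∈ Jᶜ then c ⟨j, hj⟩ else 0, ?_⟩
    rw [← hc, ← Finset.sum_coe_sort]
    exact Finset.sum_congr rfl fun j _ => by simp only [j.2, dite_true]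
  refine ⟨fun j => if j = j₀ then 1 else if j ∈ J then 0 else c j, ?_, by simp, ?_⟩
  · rw [mem_relations, ← Finset.sum_add_sum_compl J]
    have h1 : ∑ j ∈ J, (if j = j₀ then 1 else if j ∈ J then 0 else c j) • P j = P j₀ := by
      rw [Finset.sum_eq_single_of_mem j₀ hj₀]
      · simp
      · intro j hj hne
        simp [hj, hne]
    have h2 : ∑ j ∈ Jᶜ, (if j = j₀ then 1 else if j ∈ J then 0 else c j) • P j = -P j₀ := by
      rw [← hc]
      refine Finset.sum_congr rfl fun j hj => ?_
      have hj' : j ∉ J := Finset.mem_compl.1 hj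
      have hne : j ≠ j₀ := fun h => hj' (h ▸ hj₀)
      rw [if_neg hne, if_neg hj']
    rw [h1, h2, add_neg_cancel]
  · intro j hj hne
    simp [hj, hne]

/-- Double annihilator: the value vectors of linear forms make up the whole orthogonal complement of
the relations. -/
theorem exists_dotProduct_eq_of_forall_relations {P : Fin γ → Fin n → K} (z : Fin γ → K)
    (hz : ∀ w ∈ relations P, ∑ j, z j * w j = 0) : ∃ a : Fin n → K, ∀ j, a ⬝ᵥ P j = z j := by
  let E : (Fin n → K) →ₗ[K] (Fin γ → K) := Matrix.mulVecLin (Matrix.of P)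
  have hE : ∀ a j, E a j = a ⬝ᵥ P j := fun a j => dotProduct_comm (P j) a
  by_contra hcon
  have hnot : z ∉ LinearMap.range E := by
    rintro ⟨a, ha⟩
    exact hcon ⟨a, fun j => by rw [← hE, ha]⟩
  obtain ⟨f, hf, hf0⟩ := Submodule.exists_dual_map_eq_bot_of_notMem hnot inferInstance
  apply hf
  rw [dual_apply_eq_dotProduct, dotProduct_comm]
  apply hz
  rw [mem_relations]
  funext i
  have h1 : f (E (Pi.single i 1)) = 0 := by
    have : f (E (Pi.single i 1)) ∈ (LinearMap.range E).map f :=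
      Submodule.mem_map_of_mem ⟨_, rfl⟩
    rwa [hf0, Submodule.mem_bot] at this
  rw [dual_apply_eq_dotProduct] at h1
  simpa [dotProduct, hE, Pi.single_apply] using h1

/-- The action of linear forms on functions on the points, by evaluation. -/
def evalAction (P : Fin γ → Fin n → K) : (Fin n → K) →ₗ[K] (Fin γ → K) →ₗ[K] (Fin γ → K) :=
  LinearMap.mk₂ K (fun v u j => (v ⬝ᵥ P j) * u j)
    (fun _ _ _ => by funext; simp [add_dotProduct, add_mul])
    (fun _ _ _ => by funext; simp [smul_dotProduct, mul_assoc])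
    (fun _ _ _ => by funext; simp [mul_add])
    (fun _ _ _ => by funext; simp [mul_left_comm])

theorem evalAction_apply (P : Fin γ → Fin n → K) (v : Fin n → K) (u : Fin γ → K) (j : Fin γ) :
    evalAction P v u j = (v ⬝ᵥ P j) * u j := rfl

/-- The complex splits over the points, and at the j-th point contraction with a form taking the
value 1 there is a contracting homotopy. -/
theorem exists_koszul_evalAction_eq {P : Fin γ → Fin n → K} (hP : ∀ j, ∃ v, v ⬝ᵥ P j = 1) (q : ℕ)
    (φ : (Fin n → K) [⋀^Fin (q + 1)]→ₗ[K] (Fin γ → K))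
    (hφ : koszul (evalAction P) (q + 1) φ = 0) : ∃ ψ, koszul (evalAction P) q ψ = φ := by
  choose v hv using hP
  refine ⟨AlternatingMap.pi fun j => (LinearMap.proj (R := K) (φ := fun _ : Fin γ => K)
    j).compAlternatingMap (φ.curryLeft (v j)), ?_⟩
  ext1 m
  funext j
  have h := congrFun (DFunLike.congr_fun (koszul_curryLeft_of_closed _ q φ hφ (v j)) m) j
  rw [LinearMap.compAlternatingMap_apply, evalAction_apply, hv, one_mul, koszul_apply,
    Finset.sum_apply] at h
  rw [← h, koszul_apply, Finset.sum_apply]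
  rfl

end GeneralPosition

/-! ### Extension of scalars for alternating forms -/

section BaseChange

variable {K A : Type*} [Field K] [CommRing A] [Algebra K A] {n q : ℕ}

/-- Extension of scalars of an alternating form on `K^n`. -/
noncomputable def extendForm (A : Type*) [CommRing A] [Algebra K A]
    (φ : (Fin n → K) [⋀^Fin q]→ₗ[K] K) : (Fin n → A) [⋀^Fin q]→ₗ[A] A where
  toMultilinearMap := ∑ κ : Fin q → Fin n,
    algebraMap K A (φ fun i => Pi.single (κ i) 1) •
      (MultilinearMap.mkPiAlgebra A (Fin q) A).compLinearMap fun i => LinearMap.proj (κ i)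
  map_eq_zero_of_eq' := by
    intro a i j hij hne
    simp only [MultilinearMap.toFun_eq_coe, sum_apply, smul_apply,
      MultilinearMap.compLinearMap_apply, MultilinearMap.mkPiAlgebra_apply, LinearMap.proj_apply,
      smul_eq_mul]
    refine Finset.sum_involution (fun κ _ => κ ∘ Equiv.swap i j) ?_ ?_ (by simp) ?_
    · intro κ _
      have h1 : φ (fun l => Pi.single ((κ ∘ Equiv.swap i j) l) 1)
          = - φ (fun l => Pi.single (κ l) 1) :=
        φ.map_swap (fun l => Pi.single (κ l) 1) hne
      have h2 : ∏ l, a l ((κ ∘ Equiv.swap i j) l) = ∏ l, a l (κ l) := by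
        rw [← Equiv.prod_comp (Equiv.swap i j)]
        refine Finset.prod_congr rfl fun l _ => ?_
        have h3 : a (Equiv.swap i j l) = a l := by
          rcases eq_or_ne l i with rfl | hi
          · rw [Equiv.swap_apply_left, hij]
          rcases eq_or_ne l j with rfl | hj
          · rw [Equiv.swap_apply_right, hij]
          · rw [Equiv.swap_apply_of_ne_of_ne hi hj]
        rw [h3, Function.comp_apply, Equiv.swap_apply_self]
      rw [h1, h2]
      simp
    · intro κ _ h0 heq
      apply h0
      have h1 : κ i = κ j := by
        have := congrFun heq j
        simpa using this
      rw [φ.map_eq_zero_of_eq _ (by simp [h1]) hne]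
      simp
    · intro κ _
      funext l
      simp

theorem extendForm_apply (φ : (Fin n → K) [⋀^Fin q]→ₗ[K] K) (a : Fin q → Fin n → A) :
    extendForm A φ a = ∑ κ : Fin q → Fin n,
      algebraMap K A (φ fun i => Pi.single (κ i) 1) * ∏ i, a i (κ i) := by
  change (∑ κ : Fin q → Fin n, _ : MultilinearMap A _ _) a = _
  simp

theorem extendForm_single (φ : (Fin n → K) [⋀^Fin q]→ₗ[K] K) (κ : Fin q → Fin n) :
    extendForm A φ (fun i => Pi.single (κ i) 1)
      = algebraMap K A (φ fun i => Pi.single (κ i) 1) := by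
  classical
  rw [extendForm_apply, Finset.sum_eq_single κ]
  · simp
  · intro κ' _ hne
    obtain ⟨i, hi⟩ := Function.ne_iff.1 hne
    rw [Finset.prod_eq_zero (Finset.mem_univ i), mul_zero]
    simp [hi]
  · simp

theorem extendForm_ext {φ : (Fin n → K) [⋀^Fin q]→ₗ[K] K} {ψ : (Fin n → A) [⋀^Fin q]→ₗ[A] A}
    (h : ∀ κ : Fin q → Fin n, ψ (fun i => Pi.single (κ i) 1)
      = algebraMap K A (φ fun i => Pi.single (κ i) 1)) : extendForm A φ = ψ := by
  refine Module.Basis.ext_alternating (Pi.basisFun A (Fin n)) fun κ _ => ?_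
  simp only [Pi.basisFun_apply]
  rw [extendForm_single, h]

/-- Vectors act on the scalars through their pairing with a fixed vector. -/
def pairingAction {R : Type*} [CommRing R] (p : Fin n → R) : (Fin n → R) →ₗ[R] R →ₗ[R] R :=
  LinearMap.mk₂ R (fun v x => (v ⬝ᵥ p) * x)
    (fun _ _ _ => by simp [add_dotProduct, add_mul])
    (fun _ _ _ => by simp [smul_dotProduct, mul_assoc])
    (fun _ _ _ => by simp [mul_add])
    (fun _ _ _ => by simp [mul_left_comm])

theorem pairingAction_apply {R : Type*} [CommRing R] (p v : Fin n → R) (x : R) :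
    pairingAction p v x = (v ⬝ᵥ p) * x := rfl

theorem koszul_extendForm (p : Fin n → K) (g : (Fin n → K) [⋀^Fin q]→ₗ[K] K) :
    extendForm A (koszul (pairingAction p) q g)
      = koszul (pairingAction fun i => algebraMap K A (p i)) q (extendForm A g) := by
  refine extendForm_ext fun κ => ?_
  simp only [koszul_apply, pairingAction_apply, map_sum, map_zsmul, map_mul]
  refine Finset.sum_congr rfl fun i _ => ?_
  congr 2
  · simp
  · exact extendForm_single g (i.removeNth κ)

theorem extendForm_det {s : ℕ} (p : Fin s → Fin n → K) (a : Fin s → Fin n → A) :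
    extendForm A (Matrix.detRowAlternating.compLinearMap (Matrix.mulVecLin (Matrix.of p))) a
      = Matrix.det (Matrix.of fun i b => a i ⬝ᵥ fun c => algebraMap K A (p b c)) := by
  have h : extendForm A (Matrix.detRowAlternating.compLinearMap (Matrix.mulVecLin (Matrix.of p)))
      = Matrix.detRowAlternating.compLinearMap
        (Matrix.mulVecLin (Matrix.of fun b c => algebraMap K A (p b c))) := by
    refine extendForm_ext fun κ => ?_
    simp only [AlternatingMap.compLinearMap_apply]
    refine Eq.trans ?_ (RingHom.map_det (algebraMap K A) _).symm
    congr 1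
    ext i b
    simp
    rfl
  rw [h, AlternatingMap.compLinearMap_apply]
  refine congrArg Matrix.det (Matrix.ext fun i b => ?_)
  exact dotProduct_comm (fun c => algebraMap K A (p b c)) (a i)

end BaseChange

/-! ### Products of distinct linear forms -/

section SquareFree

variable {K : Type*} [Field K] {y γ : ℕ}

open MvPolynomial

/-- Induction on the degree: a variable times a product of distinct forms is expanded by writing the
variable in terms of the forms not yet used, which span by hypothesis. -/
theorem homogeneous_le_span_prod (ℓ : Fin γ → Fin y → K) (s : ℕ)
    (hℓ : ∀ J : Finset (Fin γ), J.card < s → Submodule.span K (ℓ '' (Jᶜ : Finset (Fin γ))) = ⊤) :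
    homogeneousSubmodule (Fin y) K s ≤
      Submodule.span K {Q | ∃ ι : Fin s → Fin γ, Function.Injective ι ∧
        Q = ∏ b, linForm K y (ℓ (ι b))} := by
  classical
  induction s with
  | zero =>
    intro P hP
    rw [mem_homogeneousSubmodule] at hP
    rw [← totalDegree_zero_iff_isHomogeneous, totalDegree_eq_zero_iff_eq_C] at hP
    rw [hP, ← mul_one (C _), ← smul_eq_C_mul]
    refine Submodule.smul_mem _ _ (Submodule.subset_span ⟨Fin.elim0, fun i => i.elim0, by simp⟩)
  | succ s ih =>
    have hX : ∀ c : Fin y, ∀ Q : MvPolynomial (Fin y) K, Q.IsHomogeneous s → X c * Q ∈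
        Submodule.span K {Q | ∃ ι : Fin (s + 1) → Fin γ, Function.Injective ι ∧
          Q = ∏ b, linForm K y (ℓ (ι b))} := by
      intro c Q hQ
      have hQ' := ih (fun J hJ => hℓ J (by lia)) hQ
      clear hQ
      induction hQ' using Submodule.span_induction with
      | mem Q hQ =>
        obtain ⟨ι, hι, rfl⟩ := hQ
        have h1 := hℓ (Finset.univ.image ι) (by
          rw [Finset.card_image_of_injective _ hι]; simp)
        have h2 : (Pi.single c 1 : Fin y → K) ∈ Submodule.span K
            (ℓ '' ((Finset.univ.image ι)ᶜ : Finset (Fin γ))) := by rw [h1]; trivial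
        rw [← linForm_single]
        generalize (Pi.single c 1 : Fin y → K) = x₀ at h2 ⊢
        induction h2 using Submodule.span_induction with
        | mem x hx =>
          obtain ⟨j, hj, rfl⟩ := hx
          refine Submodule.subset_span ⟨Fin.cons j ι, ?_, ?_⟩
          · rw [Fin.cons_injective_iff]
            refine ⟨?_, hι⟩
            simpa using hj
          · rw [Fin.prod_univ_succ]
            simp
        | zero => simp
        | add x z _ _ hx hz => rw [map_add, add_mul]; exact add_mem hx hz
        | smul a x _ hx => rw [map_smul, smul_mul_assoc]; exact Submodule.smul_mem _ _ hx
      | zero => simp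
      | add P Q _ _ hP hQ => rw [mul_add]; exact add_mem hP hQ
      | smul a Q _ hQ => rw [mul_smul_comm]; exact Submodule.smul_mem _ _ hQ
    intro P hP
    rw [mem_homogeneousSubmodule] at hP
    rw [← support_sum_monomial_coeff P]
    refine Submodule.sum_mem _ fun m hm => ?_
    have hdeg : m.degree = s + 1 := by
      rw [Finsupp.degree_eq_weight_one]
      exact hP (mem_support_iff.1 hm)
    obtain ⟨c, hc⟩ : ∃ c, m c ≠ 0 := by
      by_contra! h0
      rw [show m = 0 from Finsupp.ext h0] at hdeg
      simp at hdeg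
    have hle : Finsupp.single c 1 ≤ m := by
      rw [Finsupp.single_le_iff]; lia
    have hm' : m = Finsupp.single c 1 + (m - Finsupp.single c 1) := (add_tsub_cancel_of_le hle).symm
    have hX' : monomial m (coeff m P) = X c * monomial (m - Finsupp.single c 1) (coeff m P) := by
      rw [X, monomial_mul, one_mul, ← hm']
    rw [hX']
    refine hX c _ (isHomogeneous_monomial _ ?_)
    have := congrArg Finsupp.degree hm'
    rw [map_add, hdeg, Finsupp.degree_single] at this
    lia

end SquareFree

/-! ### The functional attached to the Gale transform -/

section GaleFunctional

variable {K : Type*} [Field K] {n γ : ℕ}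

/-- Dimension count: C(m+1,2) unordered pairs give that many linear conditions on K^γ. -/
theorem exists_quadric_relations {m y : ℕ} (w : Fin m → Fin γ → K)
    (hy : y + (m + 1).choose 2 ≤ γ) :
    ∃ u : Fin y → Fin γ → K, LinearIndependent K u ∧
      ∀ c l l', ∑ j, u c j * w l j * w l' j = 0 := by
  let Q : (Fin γ → K) →ₗ[K] (Sym2 (Fin m) → K) :=
    LinearMap.pi fun z => Fintype.linearCombination K fun j =>
      Sym2.lift ⟨fun l l' => w l j * w l' j, fun _ _ => mul_comm _ _⟩ z
  have h1 := Q.finrank_range_add_finrank_ker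
  have h2 : Module.finrank K (LinearMap.range Q) ≤ (m + 1).choose 2 := by
    refine (Submodule.finrank_le _).trans ?_
    simp [Sym2.card]
  rw [Module.finrank_fintype_fun_eq_card, Fintype.card_fin] at h1
  obtain ⟨u, hu⟩ := exists_linearIndependent_of_le_finrank (R := K) (M := LinearMap.ker Q)
    (n := y) (by lia)
  refine ⟨fun c => u c, hu.map' (Submodule.subtype _) (Submodule.ker_subtype _), fun c l l' => ?_⟩
  have := congrFun (LinearMap.mem_ker.1 (u c).2) s(l, l')
  simpa [Q, Fintype.linearCombination_apply, mul_assoc] using this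

variable {A : Type*} [CommRing A] [Algebra K A]

/-- The functional on cochains defined by vectors `w` and their multiples `a`. -/
noncomputable def galeFunctional {s : ℕ} (w : Fin (s + 1) → Fin γ → K)
    (a : Fin (s + 1) → Fin n → A) : ((Fin n → K) [⋀^Fin s]→ₗ[K] (Fin γ → K)) →ₗ[K] A where
  toFun e := ∑ j, ∑ l : Fin (s + 1), (-1) ^ (l : ℕ) • (algebraMap K A (w l j) *
    extendForm A ((LinearMap.proj j).compAlternatingMap e) (l.removeNth a))
  map_add' e e' := by
    simp only [extendForm_apply, ← Finset.sum_add_distrib, ← smul_add, ← mul_add]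
    simp [add_mul]
  map_smul' c e := by
    simp only [extendForm_apply, RingHom.id_apply, Finset.smul_sum, Finset.mul_sum]
    refine Finset.sum_congr rfl fun j _ => Finset.sum_congr rfl fun l _ =>
      Finset.sum_congr rfl fun κ _ => ?_
    simp only [LinearMap.compAlternatingMap_apply, AlternatingMap.smul_apply, LinearMap.proj_apply,
      Pi.smul_apply, smul_eq_mul, map_mul]
    rw [Algebra.smul_def c, mul_smul_comm]
    congr 1
    ring

theorem galeFunctional_apply {s : ℕ} (w : Fin (s + 1) → Fin γ → K)
    (a : Fin (s + 1) → Fin n → A) (e : (Fin n → K) [⋀^Fin s]→ₗ[K] (Fin γ → K)) :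
    galeFunctional w a e = ∑ j, ∑ l : Fin (s + 1), (-1) ^ (l : ℕ) • (algebraMap K A (w l j) *
      extendForm A ((LinearMap.proj j).compAlternatingMap e) (l.removeNth a)) := rfl

theorem galeFunctional_eq_zero {s : ℕ} (w : Fin (s + 1) → Fin γ → K)
    (a : Fin (s + 1) → Fin n → A) (e : (Fin n → K) [⋀^Fin s]→ₗ[K] (Fin γ → K))
    (he : ∀ l v, ∑ j, w l j * e v j = 0) : galeFunctional w a e = 0 := by
  rw [galeFunctional_apply, Finset.sum_comm]
  refine Finset.sum_eq_zero fun l _ => ?_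
  rw [← Finset.smul_sum]
  simp only [extendForm_apply, Finset.mul_sum]
  rw [Finset.sum_comm, Finset.sum_eq_zero, smul_zero]
  intro κ _
  simp only [← mul_assoc, ← map_mul, ← Finset.sum_mul, ← map_sum]
  simp only [LinearMap.compAlternatingMap_apply, LinearMap.proj_apply, he, map_zero, zero_mul]

/-- At the j-th point, pulling back along the map sending basis vectors to the `a l` turns the
Koszul differential of `P j` into `u j` times that of the vector (w l j)_l. The functional applies
the latter differential once more, so d² = 0 gives the vanishing. -/
theorem galeFunctional_koszul {q : ℕ} {P : Fin γ → Fin n → K} (w : Fin (q + 2) → Fin γ → K)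
    (a : Fin (q + 2) → Fin n → A) (u : Fin γ → A)
    (ha : ∀ l j, a l ⬝ᵥ (fun i => algebraMap K A (P j i)) = u j * algebraMap K A (w l j))
    (g : (Fin n → K) [⋀^Fin q]→ₗ[K] (Fin γ → K)) :
    galeFunctional w a (koszul (evalAction P) q g) = 0 := by
  rw [galeFunctional_apply]
  refine Finset.sum_eq_zero fun j _ => ?_
  let p : Fin (q + 2) → A := fun l => algebraMap K A (w l j)
  let L : (Fin (q + 2) → A) →ₗ[A] (Fin n → A) := Fintype.linearCombination A a
  have hL : ∀ x, L x ⬝ᵥ (fun i => algebraMap K A (P j i)) = u j * (x ⬝ᵥ p) := by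
    intro x
    simp only [L, Fintype.linearCombination_apply, sum_dotProduct, smul_dotProduct, ha]
    simp only [dotProduct, p, Finset.mul_sum, smul_eq_mul]
    exact Finset.sum_congr rfl fun l _ => by ring
  have hLs : ∀ l, L (Pi.single l 1) = a l := by
    intro l
    simp [L]
  let ψ := (extendForm A ((LinearMap.proj j).compAlternatingMap g)).compLinearMap L
  have h1 : (LinearMap.proj j).compAlternatingMap (koszul (evalAction P) q g)
      = koszul (pairingAction (P j)) q
        ((LinearMap.proj (R := K) (φ := fun _ : Fin γ => K) j).compAlternatingMap g) :=
    (koszul_compAlternatingMap _ (fun v x => rfl) q g).symm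
  have h2 : (koszul (pairingAction fun i => algebraMap K A (P j i)) q
      (extendForm A ((LinearMap.proj j).compAlternatingMap g))).compLinearMap L
      = u j • koszul (pairingAction p) q ψ := by
    ext x
    rw [AlternatingMap.compLinearMap_apply, koszul_apply, AlternatingMap.smul_apply, koszul_apply,
      Finset.smul_sum]
    refine Finset.sum_congr rfl fun i _ => ?_
    rw [pairingAction_apply, pairingAction_apply, hL, smul_comm, smul_eq_mul, mul_assoc]
    rfl
  have h3 : koszul (pairingAction p) (q + 1) (u j • koszul (pairingAction p) q ψ) = 0 := by
    rw [map_smul, koszul_koszul, smul_zero]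
    intro v w x
    simp only [pairingAction_apply]
    ring
  rw [← h2] at h3
  have h4 := DFunLike.congr_fun h3 (fun l => Pi.single l 1)
  rw [koszul_apply] at h4
  rw [h1, koszul_extendForm]
  refine Eq.trans (Finset.sum_congr rfl fun l _ => ?_) h4
  rw [pairingAction_apply, AlternatingMap.compLinearMap_apply]
  congr 2
  · simp [p]
  · congr 1
    funext i
    exact (hLs _).symm

/-- On the wedge of `s` points, placed at the point `j₀`, the alternating sum is a Laplace expansion
along the column of `j₀`; each other column contributes its factor `u`. -/
theorem galeFunctional_det {s : ℕ} {P : Fin γ → Fin n → K} (w : Fin (s + 1) → Fin γ → K)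
    (a : Fin (s + 1) → Fin n → A) (u : Fin γ → A)
    (ha : ∀ l j, a l ⬝ᵥ (fun i => algebraMap K A (P j i)) = u j * algebraMap K A (w l j))
    (j₀ : Fin γ) (ι : Fin s → Fin γ) :
    galeFunctional w a ((LinearMap.single K (fun _ => K) j₀).compAlternatingMap
      (Matrix.detRowAlternating.compLinearMap (Matrix.mulVecLin (Matrix.of (P ∘ ι)))))
      = algebraMap K A (Matrix.det (Matrix.of fun l b =>
        w l ((Fin.cons j₀ ι : Fin (s + 1) → Fin γ) b))) * ∏ b, u (ι b) := by
  rw [galeFunctional_apply, Finset.sum_eq_single j₀]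
  · have h1 : (LinearMap.proj (R := K) (φ := fun _ : Fin γ => K) j₀).compAlternatingMap
        ((LinearMap.single K (fun _ => K) j₀).compAlternatingMap
        (Matrix.detRowAlternating.compLinearMap (Matrix.mulVecLin (Matrix.of (P ∘ ι)))))
        = Matrix.detRowAlternating.compLinearMap (Matrix.mulVecLin (Matrix.of (P ∘ ι))) := by
      ext v
      simp
    rw [h1, Matrix.det_succ_column_zero, map_sum, Finset.sum_mul]
    refine Finset.sum_congr rfl fun l _ => ?_
    rw [extendForm_det]
    have h2 : (Matrix.of fun i b => (l.removeNth a i) ⬝ᵥ fun c => algebraMap K A ((P ∘ ι) b c))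
        = Matrix.of fun i b => u (ι b) * (algebraMap K A).mapMatrix
          (Matrix.of fun i b => w (l.succAbove i) (ι b)) i b := by
      ext i b
      simp only [Matrix.of_apply, Function.comp_apply, Fin.removeNth_apply, ha]
      rfl
    rw [h2, Matrix.det_mul_row, ← RingHom.map_det]
    simp only [map_mul, map_pow, map_neg, map_one, zsmul_eq_mul, Int.cast_pow, Int.cast_neg,
      Int.cast_one, Matrix.of_apply, Fin.cons_zero]
    have h3 : (Matrix.of fun l b => w l ((Fin.cons j₀ ι : Fin (s + 1) → Fin γ) b)).submatrix
        l.succAbove Fin.succ = Matrix.of fun i b => w (l.succAbove i) (ι b) := by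
      ext i b
      simp
    rw [h3]
    ring
  · intro j _ hj
    refine Finset.sum_eq_zero fun l _ => ?_
    rw [extendForm_apply]
    simp [hj]
  · simp

end GaleFunctional

/-! ### Surjectivity onto forms of degree s -/

section Existence

variable {K : Type*} [Field K] {n γ : ℕ}

/-- For points in linearly general position there is a polynomial valued functional on cochains
that vanishes on coboundaries and on cochains with values in the space of linear forms, and
attains all forms of degree `s`. -/
theorem LinearlyGeneral.exists_functional {P : Fin γ → Fin n → K} (hP : LinearlyGeneral P)
    {q y : ℕ} (hγ : γ = n + (q + 2)) (hy : y + (q + 3).choose 2 ≤ γ) :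
    ∃ Θ : ((Fin n → K) [⋀^Fin (q + 1)]→ₗ[K] (Fin γ → K)) →ₗ[K] MvPolynomial (Fin y) K,
      (∀ g, Θ (koszul (evalAction P) q g) = 0) ∧
      (∀ e, (∀ w ∈ relations P, ∀ v, ∑ j, w j * e v j = 0) → Θ e = 0) ∧
      ∀ Q : MvPolynomial (Fin y) K, Q.IsHomogeneous (q + 1) → ∃ e, Θ e = Q := by
  classical
  let bw := Module.finBasisOfFinrankEq K (relations P) (hP.finrank_relations hγ)
  let w : Fin (q + 2) → Fin γ → K := fun l => bw l
  have hw : ∀ l, w l ∈ relations P := fun l => (bw l).2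
  have hspan : ∀ z ∈ relations P, ∃ c : Fin (q + 2) → K, ∀ j, z j = ∑ l, c l * w l j := by
    intro z hz
    refine ⟨fun l => bw.repr ⟨z, hz⟩ l, fun j => ?_⟩
    have h := congrArg (fun x : relations P => (x : Fin γ → K) j) (bw.sum_repr ⟨z, hz⟩)
    simp only [Submodule.coe_sum, Submodule.coe_smul, Finset.sum_apply, Pi.smul_apply,
      smul_eq_mul] at h
    exact h.symm
  obtain ⟨u, hu, huw⟩ := exists_quadric_relations w hy
  have hex : ∀ c l, ∃ a : Fin n → K, ∀ j, a ⬝ᵥ P j = u c j * w l j := by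
    intro c l
    apply exists_dotProduct_eq_of_forall_relations
    intro z hz
    obtain ⟨d, hd⟩ := hspan z hz
    simp only [hd, Finset.mul_sum]
    rw [Finset.sum_comm]
    refine Finset.sum_eq_zero fun l' _ => ?_
    have := huw c l l'
    rw [← mul_zero (d l'), ← this, Finset.mul_sum]
    exact Finset.sum_congr rfl fun j _ => by ring
  choose a ha using hex
  let ℓ : Fin γ → Fin y → K := fun j c => u c j
  -- The generic member of the space of vectors u: the variables are its coefficients, and its j-th
  -- coordinate is the linear form with coefficients `ℓ j`.
  let ã : Fin (q + 2) → Fin n → MvPolynomial (Fin y) K :=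
    fun l i => ∑ c, a c l i • MvPolynomial.X c
  have hã : ∀ l j, ã l ⬝ᵥ (fun i => algebraMap K (MvPolynomial (Fin y) K) (P j i))
      = linForm K y (ℓ j) * algebraMap K _ (w l j) := by
    intro l j
    simp only [dotProduct, ã, linForm_apply, Finset.sum_mul]
    rw [Finset.sum_comm]
    refine Finset.sum_congr rfl fun c _ => ?_
    have h := congrArg (algebraMap K (MvPolynomial (Fin y) K)) (ha c l j)
    simp only [dotProduct, map_sum, map_mul] at h
    simp only [Algebra.smul_def, ℓ]
    rw [mul_right_comm, ← h, Finset.sum_mul]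
    exact Finset.sum_congr rfl fun i _ => by ring
  refine ⟨galeFunctional w ã, fun g => galeFunctional_koszul w ã _ hã g,
    fun e he => galeFunctional_eq_zero w ã e fun l v => he _ (hw l) v, ?_⟩
  -- Relations that are 1 at one of the chosen points and 0 at the others provide an inverse matrix.
  have hdet : ∀ ι : Fin (q + 2) → Fin γ, Function.Injective ι →
      Matrix.det (Matrix.of fun l b => w l (ι b)) ≠ 0 := by
    intro ι hι
    have h1 : ∀ b, ∃ c : Fin (q + 2) → K, ∀ b', ∑ l, c l * w l (ι b') = if b = b' then 1 else 0 := by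
      intro b
      obtain ⟨z, hz, hz1, hz0⟩ := hP.exists_relation (Finset.univ.image ι)
        (by rw [Finset.card_image_of_injective _ hι]; simp; lia) (ι b) (by simp)
      obtain ⟨c, hc⟩ := hspan z hz
      refine ⟨c, fun b' => ?_⟩
      rw [← hc]
      split_ifs with h
      · rw [← h, hz1]
      · exact hz0 _ (by simp) fun h' => h (hι h').symm
    choose C hC using h1
    have h2 : Matrix.of C * Matrix.of (fun l b => w l (ι b)) = 1 := by
      ext b b'
      rw [Matrix.mul_apply, Matrix.one_apply]
      exact hC b b'
    intro h0
    have h3 := congrArg Matrix.det h2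
    rw [Matrix.det_mul, h0, mul_zero, Matrix.det_one] at h3
    exact zero_ne_one h3
  -- Otherwise some nonzero u in the chosen space vanishes outside `J`. For j in `J` take a relation
  -- z with z_j = 1 that vanishes on the rest of `J`; then 0 = ∑ u_i z_i² = u_j, so u = 0.
  have hℓ : ∀ J : Finset (Fin γ), J.card < q + 1 →
      Submodule.span K (ℓ '' (Jᶜ : Finset (Fin γ))) = ⊤ := by
    intro J hJ
    by_contra hne
    obtain ⟨f, hf, hf0⟩ := Submodule.exists_dual_map_eq_bot_of_lt_top (lt_top_iff_ne_top.2 hne)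
      inferInstance
    apply hf
    have hzero : ∀ j ∉ J, f (ℓ j) = 0 := by
      intro j hj
      have : f (ℓ j) ∈ (Submodule.span K (ℓ '' (Jᶜ : Finset (Fin γ)))).map f :=
        Submodule.mem_map_of_mem (Submodule.subset_span ⟨j, by simpa using hj, rfl⟩)
      rwa [hf0, Submodule.mem_bot] at this
    have hall : ∀ j, f (ℓ j) = 0 := by
      intro j
      by_cases hj : j ∈ J
      · obtain ⟨z, hz, hz1, hz0⟩ := hP.exists_relation J (by lia) j hj
        obtain ⟨d, hd⟩ := hspan z hz
        have h1 : ∀ c, ∑ i, u c i * z i * z i = 0 := by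
          intro c
          have h2 : ∀ i, u c i * z i * z i
              = ∑ l, ∑ l', d l * d l' * (u c i * w l i * w l' i) := by
            intro i
            rw [hd i, mul_assoc, Finset.sum_mul_sum, Finset.mul_sum]
            refine Finset.sum_congr rfl fun l _ => ?_
            rw [Finset.mul_sum]
            exact Finset.sum_congr rfl fun l' _ => by ring
          rw [Finset.sum_congr rfl fun i _ => h2 i, Finset.sum_comm]
          refine Finset.sum_eq_zero fun l _ => ?_
          rw [Finset.sum_comm]
          refine Finset.sum_eq_zero fun l' _ => ?_
          rw [← Finset.mul_sum, huw, mul_zero]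
        have h3 : ∑ i, f (ℓ i) * z i * z i = 0 := by
          have h4 : ∀ i, f (ℓ i) = ∑ c, f (Pi.single c 1) * u c i :=
            fun i => dual_apply_eq_dotProduct f (ℓ i)
          simp only [h4, Finset.sum_mul]
          rw [Finset.sum_comm]
          refine Finset.sum_eq_zero fun c _ => ?_
          rw [← mul_zero (f (Pi.single c 1)), ← h1 c, Finset.mul_sum]
          exact Finset.sum_congr rfl fun i _ => by ring
        rw [Finset.sum_eq_single j] at h3
        · simpa [hz1] using h3
        · intro i _ hij
          by_cases hi : i ∈ J
          · rw [hz0 i hi hij, mul_zero]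
          · rw [hzero i hi, zero_mul, zero_mul]
        · simp
      · exact hzero j hj
    have hli := Fintype.linearIndependent_iff.1 hu (fun c => f (Pi.single c 1)) (by
      funext j
      have := hall j
      rw [dual_apply_eq_dotProduct] at this
      simpa [dotProduct, ℓ] using this)
    refine LinearMap.ext fun x => ?_
    rw [dual_apply_eq_dotProduct]
    simp [dotProduct, hli]
  intro Q hQ
  have hrange : Submodule.span K {Q | ∃ ι : Fin (q + 1) → Fin γ, Function.Injective ι ∧
      Q = ∏ b, linForm K y (ℓ (ι b))} ≤ LinearMap.range (galeFunctional w ã) := by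
    rw [Submodule.span_le]
    rintro _ ⟨ι, hι, rfl⟩
    obtain ⟨j₀, hj₀⟩ : ∃ j₀, j₀ ∉ Set.range ι := by
      by_contra! h
      have := Fintype.card_le_of_surjective ι h
      simp at this
      lia
    have h1 := galeFunctional_det w ã _ hã j₀ ι
    have h2 := hdet (Fin.cons j₀ ι) (Fin.cons_injective_iff.2 ⟨hj₀, hι⟩)
    set D := Matrix.det (Matrix.of fun l b => w l ((Fin.cons j₀ ι : Fin (q + 2) → Fin γ) b))
    have h3 := (LinearMap.range (galeFunctional w ã)).smul_mem D⁻¹ (LinearMap.mem_range.2 ⟨_, h1⟩)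
    rwa [← Algebra.smul_def, smul_smul, inv_mul_cancel₀ h2, one_smul] at h3
  exact hrange (homogeneous_le_span_prod ℓ (q + 1) hℓ hQ)

end Existence

/-! ### Dimension of the space of forms -/

section Forms

variable {K : Type*} [Field K]

open MvPolynomial in
theorem finrank_homogeneousSubmodule (y s : ℕ) :
    Module.finrank K (homogeneousSubmodule (Fin y) K s) = y.multichoose s := by
  classical
  rw [homogeneousSubmodule_eq_finsupp_supported]
  have h1 : {d : Fin y →₀ ℕ | d.degree = s}
      = ↑(Finset.finsuppAntidiag (Finset.univ : Finset (Fin y)) s) := by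
    ext d
    simp [Finset.mem_finsuppAntidiag, Finsupp.degree_eq_sum]
  rw [h1]
  refine (AddMonoidAlgebra.supportedEquivFinsupp (R := K) (S := K) _).finrank_eq.trans ?_
  rw [Module.finrank_finsupp_self]
  simp [Finset.card_finsuppAntidiag_nat_eq_multichoose]

end Forms

/-! ### The ideal of the points and the Betti number bound -/

section Ideal

variable {K : Type u} [Field K] {r γ : ℕ}

/-- The ideal generated by the forms that vanish at given vectors. -/
noncomputable def formsIdeal (v : Fin γ → Fin (r + 1) → K) : Ideal (CoordRing K r) :=
  Ideal.span {F | (∃ n, F.IsHomogeneous n) ∧ ∀ i, MvPolynomial.eval (v i) F = 0}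

theorem eval_smul_of_isHomogeneous {n : ℕ} {F : CoordRing K r} (hF : F.IsHomogeneous n) (c : K)
    (x : Fin (r + 1) → K) :
    MvPolynomial.eval (c • x) F = c ^ n * MvPolynomial.eval x F := by
  rw [MvPolynomial.eval_eq, MvPolynomial.eval_eq, Finset.mul_sum]
  refine Finset.sum_congr rfl fun d hd => ?_
  have h : d.degree = n := by
    rw [Finsupp.degree_eq_weight_one]
    exact hF (MvPolynomial.mem_support_iff.1 hd)
  simp only [Pi.smul_apply, smul_eq_mul, mul_pow, Finset.prod_mul_distrib]
  rw [Finset.prod_pow_eq_pow_sum, ← h, Finsupp.degree_apply]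
  ring

theorem pointsIdeal_mk (v : Fin γ → Fin (r + 1) → K) (hv : ∀ i, v i ≠ 0) :
    pointsIdeal (fun i => Projectivization.mk K (v i) (hv i)) = formsIdeal v := by
  unfold pointsIdeal formsIdeal
  congr 1
  ext F
  simp only [Set.mem_ofPred_eq]
  refine and_congr_right fun ⟨n, hn⟩ => forall_congr' fun i => ?_
  obtain ⟨a, ha⟩ := Projectivization.exists_smul_eq_mk_rep K (v i) (hv i)
  rw [← ha, Units.smul_def, eval_smul_of_isHomogeneous hn]
  simp

theorem mem_formsIdeal {v : Fin γ → Fin (r + 1) → K} {n : ℕ} {F : CoordRing K r}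
    (hF : F.IsHomogeneous n) (h : ∀ i, MvPolynomial.eval (v i) F = 0) : F ∈ formsIdeal v :=
  Ideal.subset_span ⟨⟨n, hF⟩, h⟩

theorem shiftedComponent_mem_formsIdeal (v : Fin γ → Fin (r + 1) → K) (F : CoordRing K r)
    (hF : F ∈ formsIdeal v) (j : ℕ) : shiftedComponent 0 j F ∈ formsIdeal v := by
  let := MvPolynomial.gradedAlgebra (σ := Fin (r + 1)) (R := K)
  have h : (formsIdeal v).IsHomogeneous (MvPolynomial.homogeneousSubmodule (Fin (r + 1)) K) :=
    Ideal.homogeneous_span _ _ fun x hx => hx.1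
  simpa [shiftedComponent] using (MvPolynomial.mem_iff_homogeneousComponent_mem h F).1 hF j

/-- Evaluation of polynomials at given vectors. -/
noncomputable def evalMap (v : Fin γ → Fin (r + 1) → K) : CoordRing K r →ₗ[K] (Fin γ → K) :=
  LinearMap.pi fun i => (MvPolynomial.aeval (v i)).toLinearMap

theorem evalMap_apply (v : Fin γ → Fin (r + 1) → K) (F : CoordRing K r) (i : Fin γ) :
    evalMap v F i = MvPolynomial.eval (v i) F := by
  simp [evalMap]

theorem eval_linForm (x a : Fin (r + 1) → K) :
    MvPolynomial.eval x (linForm K (r + 1) a) = a ⬝ᵥ x := by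
  simp [linForm_apply, dotProduct, MvPolynomial.smul_eval]

theorem evalMap_moduleAction (v : Fin γ → Fin (r + 1) → K) (a : Fin (r + 1) → K)
    (F : CoordRing K r) :
    evalMap v (moduleAction (r + 1) _ a F) = evalAction v a (evalMap v F) := by
  funext i
  rw [evalMap_apply, moduleAction_apply, smul_eq_mul, map_mul, eval_linForm, evalAction_apply,
    evalMap_apply]

theorem evalMap_eq_zero_of_mem (v : Fin γ → Fin (r + 1) → K) (F : CoordRing K r)
    (hF : F ∈ formsIdeal v) : evalMap v F = 0 := by
  funext i
  rw [evalMap_apply]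
  have h : formsIdeal v ≤ RingHom.ker (MvPolynomial.eval (v i)) :=
    Ideal.span_le.2 fun G hG => hG.2 i
  exact h hF

theorem isHomogeneous_one_iff {F : CoordRing K r} :
    F.IsHomogeneous 1 ↔ ∃ a, linForm K (r + 1) a = F := by
  constructor
  · intro hF
    have h : F ∈ Submodule.span K (Set.range MvPolynomial.X) := by
      rw [← MvPolynomial.homogeneousSubmodule_one_eq_span_X]
      exact hF
    rwa [← Fintype.range_linearCombination K MvPolynomial.X] at h
  · rintro ⟨a, rfl⟩
    exact isHomogeneous_linForm a

theorem sum_relation_mul_evalMap {v : Fin γ → Fin (r + 1) → K} {w : Fin γ → K}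
    (hw : w ∈ relations v) {F : CoordRing K r} (hF : F.IsHomogeneous 1) :
    ∑ j, w j * evalMap v F j = 0 := by
  obtain ⟨a, rfl⟩ := isHomogeneous_one_iff.1 hF
  simp only [evalMap_apply, eval_linForm]
  exact sum_mul_dotProduct_of_mem_relations hw a

/-- The other γ - 1 ≤ 2r points split into two sets of at most r, each on a hyperplane avoiding the
given point; powers of one equation adjust the degree. -/
theorem LinearlyGeneral.exists_separating_form {v : Fin γ → Fin (r + 1) → K}
    (hv : LinearlyGeneral v) (h1 : r + 1 ≤ γ) (h2 : γ ≤ 2 * r + 1) (d : ℕ) (j₀ : Fin γ) :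
    ∃ F : CoordRing K r, F.IsHomogeneous (d + 2) ∧ evalMap v F = Pi.single j₀ 1 := by
  classical
  have hcard : (Finset.univ.erase j₀).card = γ - 1 := by simp
  obtain ⟨J, hJ, hJc⟩ := Finset.exists_subset_card_eq (s := Finset.univ.erase j₀) (n := r)
    (by lia)
  have hJ2 : ((Finset.univ.erase j₀) \ J).card = γ - 1 - r := by
    rw [Finset.card_sdiff_of_subset hJ, hcard, hJc]
  obtain ⟨a, ha1, ha⟩ := hv.exists_form h1 J (by lia) (j₀ := j₀)
    fun h => by simpa using hJ h
  obtain ⟨b, hb1, hb⟩ := hv.exists_form h1 ((Finset.univ.erase j₀) \ J) (by lia) (j₀ := j₀)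
    (by simp)
  refine ⟨linForm K _ a ^ (d + 1) * linForm K _ b, ?_, ?_⟩
  · have := ((isHomogeneous_linForm a).pow (d + 1)).mul (isHomogeneous_linForm b)
    simpa using this
  · funext j
    rw [evalMap_apply, map_mul, map_pow, eval_linForm, eval_linForm]
    by_cases hj : j = j₀
    · subst hj
      simp [ha1, hb1]
    · rw [Pi.single_eq_of_ne hj]
      by_cases hjJ : j ∈ J
      · rw [ha j hjJ]; simp
      · rw [hb j (by simp [hj, hjJ])]; simp

theorem LinearlyGeneral.exists_section {v : Fin γ → Fin (r + 1) → K}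
    (hv : LinearlyGeneral v) (h1 : r + 1 ≤ γ) (h2 : γ ≤ 2 * r + 1) (d : ℕ) :
    ∃ σ : (Fin γ → K) →ₗ[K] CoordRing K r, (∀ x, (σ x).IsHomogeneous (d + 2)) ∧
      ∀ x, evalMap v (σ x) = x := by
  choose F hF hFe using fun j => hv.exists_separating_form h1 h2 d j
  refine ⟨Fintype.linearCombination K F, fun x => ?_, fun x => ?_⟩
  · rw [Fintype.linearCombination_apply, ← MvPolynomial.mem_homogeneousSubmodule]
    exact Submodule.sum_mem _ fun j _ => Submodule.smul_mem _ _ (hF j)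
  · rw [Fintype.linearCombination_apply, map_sum]
    simp only [map_smul, hFe]
    exact (pi_eq_sum_univ' x).symm

/-- The lower bound for a graded Betti number that comes from the Gale transform. -/
theorem LinearlyGeneral.multichoose_le_betti {v : Fin γ → Fin (r + 1) → K}
    (hv : LinearlyGeneral v) {q i y : ℕ} (hγ : γ = r + q + 3) (hi : q + 1 + i = r) (hi0 : 0 < i)
    (hy : y + (q + 3).choose 2 ≤ γ) (F : MinimalFreeResolution (formsIdeal v)) :
    y.multichoose (q + 1) ≤ F.betti i (2 + i) := by
  obtain ⟨Θ, hΘk, hΘ0, hΘs⟩ := hv.exists_functional (q := q) (y := y) (by lia) hy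
  obtain ⟨σ, hσ, hσe⟩ := hv.exists_section (by lia) (by lia) 0
  obtain ⟨g, hg⟩ := exists_partial_rightInverse Θ
  let T := MvPolynomial.homogeneousSubmodule (Fin y) K (q + 1)
  let e : T →ₗ[K] _ := g ∘ₗ T.subtype
  have he : ∀ t : T, Θ (e t) = t := by
    intro t
    obtain ⟨x, hx⟩ := hΘs t t.2
    change Θ (g t) = t
    rw [← hx, hg]
  let φ : T →ₗ[K] ((Fin (r + 1) → K) [⋀^Fin (q + 1 + 1)]→ₗ[K] CoordRing K r) :=
    LinearMap.compAlternatingMapₗ K σ ∘ₗ koszul (evalAction v) (q + 1) ∘ₗ e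
  have hφ : ∀ t x, φ t x = σ (koszul (evalAction v) (q + 1) (e t) x) := fun _ _ => rfl
  have hEφ : ∀ t, (evalMap v).compAlternatingMap (φ t) = koszul (evalAction v) (q + 1) (e t) := by
    intro t
    ext1 x
    rw [LinearMap.compAlternatingMap_apply, hφ, hσe]
  have hcomm : ∀ a b x, evalAction v a (evalAction v b x) = evalAction v b (evalAction v a x) := by
    intro a b x
    funext j
    simp only [evalAction_apply]
    ring
  rw [← finrank_homogeneousSubmodule (K := K)]
  refine F.finrank_le_betti (shiftedComponent_mem_formsIdeal v) hi φ (fun t x => hσ _) ?_ ?_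
  · intro t x
    refine mem_formsIdeal (n := 3) ?_ fun j => ?_
    · rw [koszul_apply, ← MvPolynomial.mem_homogeneousSubmodule]
      refine Submodule.sum_mem _ fun l _ => zsmul_mem ?_ _
      have := (isHomogeneous_linForm (x l)).mul (hσ (koszul (evalAction v) (q + 1) (e t)
        (l.removeNth x)))
      exact this
    · have h := koszul_compAlternatingMap (evalMap v) (evalMap_moduleAction v) _ (φ t)
      rw [hEφ, koszul_koszul _ hcomm] at h
      have h2 := congrFun (DFunLike.congr_fun h x) j
      rw [LinearMap.compAlternatingMap_apply, evalMap_apply] at h2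
      exact h2.symm
  · intro t ψ hψ
    -- The cochain `ψ` has arbitrary values; since φ takes quadratic values, only the linear part of
    -- `ψ` matters, and this is what Θ annihilates.
    let ψ₁ := (shiftedComponent 0 1 : CoordRing K r →ₗ[K] CoordRing K r).compAlternatingMap ψ
    have h1 : ∀ x, φ t x - koszul (moduleAction (r + 1) _) (q + 1) ψ₁ x ∈ formsIdeal v := by
      intro x
      have h := shiftedComponent_mem_formsIdeal v _ (hψ x) 2
      have hd : shiftedComponent 0 2 (φ t x) = φ t x := shiftedComponent_of_isHomogeneous (hσ _)
      rw [map_sub, hd] at h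
      convert h using 2
      rw [koszul_apply, koszul_apply, map_sum]
      refine Finset.sum_congr rfl fun l _ => ?_
      rw [map_zsmul, moduleAction_apply, moduleAction_apply, smul_eq_mul, smul_eq_mul,
        shiftedComponent_linForm_mul]
      rfl
    have h2 : koszul (evalAction v) (q + 1) (e t - (evalMap v).compAlternatingMap ψ₁) = 0 := by
      rw [map_sub, sub_eq_zero, koszul_compAlternatingMap (evalMap v) (evalMap_moduleAction v),
        ← hEφ]
      ext1 x
      have h := evalMap_eq_zero_of_mem v _ (h1 x)
      rw [map_sub, sub_eq_zero] at h
      exact h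
    obtain ⟨z, hz⟩ := exists_koszul_evalAction_eq (P := v) (fun j => by
      obtain ⟨a, ha, -⟩ := hv.exists_form (by lia) ∅ (by simp) (j₀ := j) (by simp)
      exact ⟨a, ha⟩) q _ h2
    have h3 := hΘk z
    rw [hz, map_sub, he, hΘ0 _ fun w hw x => ?_, sub_zero] at h3
    · exact Subtype.ext h3
    · exact sum_relation_mul_evalMap hw (isHomogeneous_shiftedComponent 1 _)

end Ideal

/-! ### Hilbert function and numerator -/

section Hilbert

theorem finrank_map_eq_of_ker {K M N N' : Type*} [Field K] [AddCommGroup M] [Module K M]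
    [AddCommGroup N] [Module K N] [AddCommGroup N'] [Module K N'] (p : Submodule K M)
    (f : M →ₗ[K] N) (g : M →ₗ[K] N') (h : ∀ x ∈ p, f x = 0 ↔ g x = 0) :
    Module.finrank K (p.map f) = Module.finrank K (p.map g) := by
  rw [← LinearMap.range_domRestrict, ← LinearMap.range_domRestrict]
  have hk : LinearMap.ker (f.domRestrict p) = LinearMap.ker (g.domRestrict p) := by
    ext x
    exact h x x.2
  exact ((f.domRestrict p).quotKerEquivRange.symm.trans ((Submodule.quotEquivOfEq _ _ hk).trans
    (g.domRestrict p).quotKerEquivRange)).finrank_eq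

variable {K : Type u} [Field K] {r γ : ℕ}

theorem hilbertFn_formsIdeal (v : Fin γ → Fin (r + 1) → K) (n : ℕ) :
    hilbertFn (formsIdeal v) n = Module.finrank K
      ((MvPolynomial.homogeneousSubmodule (Fin (r + 1)) K n).map (evalMap v)) := by
  refine finrank_map_eq_of_ker _ _ _ fun F hF => ?_
  have h : (Ideal.Quotient.mkₐ K (formsIdeal v)).toLinearMap F = 0 ↔ F ∈ formsIdeal v :=
    Ideal.Quotient.eq_zero_iff_mem
  rw [h]
  refine ⟨evalMap_eq_zero_of_mem v F, fun h0 => mem_formsIdeal hF fun j => ?_⟩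
  rw [← evalMap_apply, h0]
  rfl

theorem hilbertFn_formsIdeal_zero (v : Fin γ → Fin (r + 1) → K) (hγ : 0 < γ) :
    hilbertFn (formsIdeal v) 0 = 1 := by
  rw [hilbertFn_formsIdeal, MvPolynomial.homogeneousSubmodule_zero, Submodule.one_eq_span,
    Submodule.map_span, Set.image_singleton]
  refine finrank_span_singleton fun h => ?_
  have := congrFun h ⟨0, hγ⟩
  simp [evalMap_apply] at this

theorem LinearlyGeneral.hilbertFn_one {v : Fin γ → Fin (r + 1) → K} (hv : LinearlyGeneral v)
    (hγ : r + 1 ≤ γ) : hilbertFn (formsIdeal v) 1 = r + 1 := by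
  have h : MvPolynomial.homogeneousSubmodule (Fin (r + 1)) K 1
      = LinearMap.range (linForm K (r + 1)) := by
    ext F
    exact isHomogeneous_one_iff
  rw [hilbertFn_formsIdeal, h, ← LinearMap.range_comp, LinearMap.finrank_range_of_inj]
  · simp
  · rw [← LinearMap.ker_eq_bot, LinearMap.ker_eq_bot']
    intro a ha
    have h1 : ∀ j, a ⬝ᵥ v j = 0 := by
      intro j
      have := congrFun ha j
      rwa [LinearMap.comp_apply, evalMap_apply, eval_linForm] at this
    have h2 : ∀ x, a ⬝ᵥ x = 0 := by
      intro x
      have hx : x ∈ Submodule.span K (v '' (Finset.univ : Finset (Fin γ))) := by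
        rw [hv.span_eq_top _ (by simpa using hγ)]
        trivial
      induction hx using Submodule.span_induction with
      | mem x hx =>
        obtain ⟨j, -, rfl⟩ := hx
        exact h1 j
      | zero => simp
      | add x y _ _ hx hy => rw [dotProduct_add, hx, hy, add_zero]
      | smul c x _ hx => rw [dotProduct_smul, hx, smul_zero]
    funext i
    simpa using h2 (Pi.single i 1)

theorem LinearlyGeneral.hilbertFn_add_two {v : Fin γ → Fin (r + 1) → K} (hv : LinearlyGeneral v)
    (h1 : r + 1 ≤ γ) (h2 : γ ≤ 2 * r + 1) (n : ℕ) : hilbertFn (formsIdeal v) (n + 2) = γ := by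
  obtain ⟨σ, hσ, hσe⟩ := hv.exists_section h1 h2 n
  rw [hilbertFn_formsIdeal]
  have : (MvPolynomial.homogeneousSubmodule (Fin (r + 1)) K (n + 2)).map (evalMap v) = ⊤ := by
    rw [eq_top_iff]
    intro x _
    exact ⟨σ x, hσ x, hσe x⟩
  rw [this]
  simp

open PowerSeries in
theorem coeff_one_sub_X_pow (r k : ℕ) :
    coeff k ((1 - X : ℤ⟦X⟧) ^ r) = (-1) ^ k * (r.choose k : ℤ) := by
  induction r generalizing k with
  | zero => rcases k with _ | k <;> simp [coeff_one]
  | succ r ih =>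
    rw [pow_succ, mul_sub, mul_one, map_sub, ih]
    rcases k with _ | k
    · simp
    · rw [coeff_succ_mul_X, ih, Nat.choose_succ_succ]
      push_cast
      ring

-- The Hilbert function is 1, r + 1, γ, γ, …, so the numerator is (1-t)^r (1 + rt + (γ-r-1)t²).
open PowerSeries in
theorem LinearlyGeneral.hilbertNumerator_add_two {v : Fin γ → Fin (r + 1) → K}
    (hv : LinearlyGeneral v) (h1 : r + 1 ≤ γ) (h2 : γ ≤ 2 * r + 1) (i : ℕ) :
    (-1) ^ i * hilbertNumerator (formsIdeal v) (i + 2)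
      = (r.choose (i + 2) : ℤ) - r * r.choose (i + 1) + (γ - r - 1) * r.choose i := by
  obtain ⟨ρ, hρ⟩ : ∃ ρ : ℤ, ρ = r := ⟨_, rfl⟩
  obtain ⟨δ, hδ⟩ : ∃ δ : ℤ, δ = γ - r - 1 := ⟨_, rfl⟩
  rw [← hδ, ← hρ]
  have hmul : (PowerSeries.mk fun n => (hilbertFn (formsIdeal v) n : ℤ)) * (1 - X)
      = 1 + C ρ * X + C δ * X ^ 2 := by
    ext n
    rw [mul_sub, mul_one, map_sub, coeff_mk, map_add, map_add, coeff_C_mul, coeff_C_mul,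
      coeff_one, coeff_X, coeff_X_pow]
    rcases n with _ | _ | _ | n
    · simp [hilbertFn_formsIdeal_zero v (by lia : 0 < γ)]
    · rw [zero_add, show (1 : ℕ) = 0 + 1 from rfl, coeff_succ_mul_X, coeff_mk, zero_add,
        hv.hilbertFn_one h1, hilbertFn_formsIdeal_zero v (by lia : 0 < γ)]
      simp [hρ]
    · rw [coeff_succ_mul_X, coeff_mk, zero_add, show 1 + 1 = 0 + 2 from rfl,
        hv.hilbertFn_add_two h1 h2, hv.hilbertFn_one h1]
      simp [hδ]
      ring
    · rw [coeff_succ_mul_X, coeff_mk, show n + 1 + 1 + 1 = (n + 1) + 2 from rfl,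
        hv.hilbertFn_add_two h1 h2, show n + 1 + 1 = n + 2 from rfl, hv.hilbertFn_add_two h1 h2]
      simp
  have hsplit : (PowerSeries.mk fun n => (hilbertFn (formsIdeal v) n : ℤ)) * (1 - X) ^ (r + 1)
      = (1 - X) ^ r + C ρ * ((1 - X) ^ r * X)
        + C δ * ((1 - X) ^ r * X ^ 2) := by
    rw [pow_succ', ← mul_assoc, hmul]
    ring
  have hsq : ((-1 : ℤ) ^ i) * (-1) ^ i = 1 := by
    rw [← mul_pow]; simp
  unfold hilbertNumerator
  rw [hsplit, map_add, map_add, coeff_C_mul, coeff_C_mul, coeff_mul_X_pow,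
    show i + 2 = (i + 1) + 1 from rfl, coeff_succ_mul_X, coeff_one_sub_X_pow, coeff_one_sub_X_pow,
    coeff_one_sub_X_pow, pow_succ, pow_succ]
  linear_combination ((r.choose (i + 2) : ℤ) - ρ * r.choose (i + 1) + δ * r.choose i) * hsq

end Hilbert

/-! ### The open set of point configurations and the numerical criterion -/

section Criterion

/-- Vectors with nonzero maximal minors are in linearly general position. -/
theorem linearlyGeneral_of_det_ne_zero {K : Type*} [Field K] {n γ : ℕ} {v : Fin γ → Fin n → K}
    (h : ∀ ι : Fin n ↪ Fin γ, Matrix.det (Matrix.of fun b => v (ι b)) ≠ 0) :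
    LinearlyGeneral v := fun ι hι =>
  Matrix.linearIndependent_rows_of_det_ne_zero (h ⟨ι, hι⟩)

/-- The product of all maximal minors of a generic matrix. -/
noncomputable def minorsProduct (k : Type*) [Field k] (γ n : ℕ) :
    MvPolynomial (Fin γ × Fin n) k :=
  ∏ ι : Fin n ↪ Fin γ, Matrix.det (Matrix.of fun b c => MvPolynomial.X (ι b, c))

theorem minorsProduct_ne_zero (k : Type*) [Field k] (γ n : ℕ) : minorsProduct k γ n ≠ 0 := by
  refine Finset.prod_ne_zero_iff.2 fun ι _ => ?_
  have hinj : Function.Injective (Prod.map ι id : Fin n × Fin n → Fin γ × Fin n) :=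
    ι.injective.prodMap Function.injective_id
  have h : Matrix.det (Matrix.of fun b c => MvPolynomial.X (ι b, c))
      = MvPolynomial.rename (R := k) (Prod.map ι id)
        (Matrix.det (Matrix.mvPolynomialX (Fin n) (Fin n) k)) := by
    rw [AlgHom.map_det]
    congr 1
    ext1 b c
    simp
  rw [h]
  exact (map_ne_zero_iff _ (MvPolynomial.rename_injective _ hinj)).2
    (Matrix.det_mvPolynomialX_ne_zero _ _)

theorem aeval_minorsProduct {k K : Type*} [Field k] [Field K] [Algebra k K] {γ n : ℕ}
    (v : Fin γ → Fin n → K) :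
    MvPolynomial.aeval (fun x : Fin γ × Fin n => v x.1 x.2) (minorsProduct k γ n)
      = ∏ ι : Fin n ↪ Fin γ, Matrix.det (Matrix.of fun b => v (ι b)) := by
  rw [minorsProduct, map_prod]
  refine Finset.prod_congr rfl fun ι _ => ?_
  rw [AlgHom.map_det]
  congr 1
  ext b c
  simp

/-- The Minimal Resolution Conjecture fails if the bound from the Gale transform exceeds
the expected Betti number. -/
theorem mrcFails_of_lt (k : Type u) [Field k] {r γ q i y : ℕ} (hγ : γ = r + q + 3)
    (hi : q + 1 + i = r) (hi0 : 0 < i) (hy : y + (q + 3).choose 2 ≤ γ)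
    (hlt : max ((r.choose (i + 2) : ℤ) - r * r.choose (i + 1) + (q + 2) * r.choose i) 0
      < y.multichoose (q + 1)) : MRCFails k r γ := by
  refine ⟨minorsProduct k γ (r + 1), minorsProduct_ne_zero k γ (r + 1), ?_⟩
  intro K _ _ v hv0 hf
  rw [aeval_minorsProduct, Finset.prod_ne_zero_iff] at hf
  have hv : LinearlyGeneral v := linearlyGeneral_of_det_ne_zero fun ι => hf ι (Finset.mem_univ _)
  unfold SatisfiesMRC
  rw [pointsIdeal_mk]
  rintro ⟨F, hF⟩
  have h1 := hv.multichoose_le_betti hγ hi hi0 hy F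
  have h2 := hF i (i + 2)
  have h3 := hv.hilbertNumerator_add_two (by lia) (by lia) i
  -- The initial degree need not be known: if it does not match this position, the expected number
  -- is 0.
  have h4 : expectedBetti (formsIdeal v) i (i + 2)
      ≤ max ((-1) ^ i * hilbertNumerator (formsIdeal v) (i + 2)) 0 := by
    unfold expectedBetti
    rw [if_neg hi0.ne']
    split_ifs
    · exact le_rfl
    · exact le_max_right _ _
  rw [h3, ← h2, show (γ : ℤ) - r - 1 = q + 2 by rw [hγ]; push_cast; ring] at h4
  rw [add_comm 2 i] at h1
  have h5 : (y.multichoose (q + 1) : ℤ) ≤ F.betti i (i + 2) := by exact_mod_cast h1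
  exact absurd (h5.trans h4) (not_le.2 hlt)

/-- Up to positive factors the expression is r + 2 - (q+1)², by the ratios of consecutive binomial
coefficients. -/
theorem expected_nonpos {r q i : ℕ} (hi : q + 1 + i = r) (hs : r + 2 ≤ (q + 1) ^ 2) :
    (r.choose (i + 2) : ℤ) - r * r.choose (i + 1) + (q + 2) * r.choose i ≤ 0 := by
  have h1 : (r.choose (i + 1) : ℤ) * (i + 1) = r.choose i * (q + 1) := by
    have := Nat.choose_succ_right_eq r i
    rw [show r - i = q + 1 by lia] at this
    exact_mod_cast this
  have h2 : (r.choose (i + 2) : ℤ) * (i + 2) = r.choose (i + 1) * q := by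
    have := Nat.choose_succ_right_eq r (i + 1)
    rw [show r - (i + 1) = q by lia] at this
    exact_mod_cast this
  have hr : (r : ℤ) = q + 1 + i := by rw [← hi]; push_cast; ring
  have hs' : (r : ℤ) + 2 ≤ (q + 1) ^ 2 := by exact_mod_cast hs
  have hc : (0 : ℤ) ≤ r.choose i := by positivity
  set c0 : ℤ := (r.choose i : ℤ)
  set c1 : ℤ := (r.choose (i + 1) : ℤ)
  set c2 : ℤ := (r.choose (i + 2) : ℤ)
  have key : (c2 - r * c1 + (q + 2) * c0) * ((i + 2) * (i + 1))
      = -(c0 * ((q + 1) ^ 2 - (r + 2)) * (i + 1)) := by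
    rw [hr]
    linear_combination (i + 1 : ℤ) * h2 + ((q : ℤ) - (q + 1 + i) * (i + 2)) * h1
  have hneg : (c2 - r * c1 + (q + 2) * c0) * ((i + 2) * (i + 1)) ≤ 0 := by
    rw [key]
    have : 0 ≤ c0 * ((q + 1) ^ 2 - (r + 2)) * (i + 1) := by
      have h3 : (0 : ℤ) ≤ (q + 1) ^ 2 - (r + 2) := by linarith
      positivity
    linarith
  by_contra! hpos
  have : 0 < (c2 - r * c1 + (q + 2) * c0) * ((i + 2) * (i + 1)) := by positivity
  linarith

/-- With `y = 1` the space of forms of degree s has dimension 1, and 1 + C(s+2,2) ≤ r + s + 2 is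
equivalent to s(s+1) ≤ 2r. -/
theorem mrcFails_of_le {k : Type u} [Field k] {r s : ℕ} (hr : 6 ≤ r) (h1 : r + 2 ≤ s ^ 2)
    (h2 : s * (s + 1) ≤ 2 * r) : MRCFails k r (r + s + 2) := by
  have hs : 3 ≤ s := by
    by_contra! h
    interval_cases s <;> lia
  obtain ⟨q, rfl⟩ : ∃ q, s = q + 1 := ⟨s - 1, by lia⟩
  have hsr : q + 1 < r := by nlinarith
  refine mrcFails_of_lt k (q := q) (i := r - (q + 1)) (y := 1) (by lia) (by lia) (by lia) ?_ ?_
  · have h3 : 2 * (q + 3).choose 2 = (q + 3) * (q + 2) := by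
      rw [Nat.choose_two_right, Nat.mul_div_cancel' (Nat.even_mul_pred_self _).two_dvd]
      rfl
    nlinarith
  · rw [max_eq_right (expected_nonpos (by lia) h1)]
    simp

end Criterion

/-! ### Number of admissible γ -/

section Counting

theorem abs_ncard_sub_lt {r : ℕ} (hr : 6 ≤ r) :
    |(Set.ncard {γ : ℕ | (r : ℝ) + 2 + √((r : ℝ) + 2) ≤ (γ : ℝ) ∧
          (γ : ℝ) ≤ (r : ℝ) + (3 + √(8 * (r : ℝ) + 1)) / 2} : ℝ)
        - (√2 - 1) * √(r : ℝ)| < 2 := by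
  have hr' : (6 : ℝ) ≤ r := by exact_mod_cast hr
  set a : ℝ := (r : ℝ) + 2 + √((r : ℝ) + 2) with ha
  set b : ℝ := (r : ℝ) + (3 + √(8 * (r : ℝ) + 1)) / 2 with hb
  have ha0 : 0 ≤ a := by positivity
  have hb0 : 0 ≤ b := by positivity
  have hset : {γ : ℕ | a ≤ (γ : ℝ) ∧ (γ : ℝ) ≤ b} = Set.Icc ⌈a⌉₊ ⌊b⌋₊ := by
    ext γ
    simp [Nat.ceil_le, Nat.le_floor_iff hb0]
  rw [hset, ← Finset.coe_Icc, Set.ncard_coe_finset, Nat.card_Icc]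
  have hca := Nat.ceil_lt_add_one ha0
  have hca' := Nat.le_ceil a
  have hfb := Nat.lt_floor_add_one b
  have hfb' := Nat.floor_le hb0
  have hlow : b - a - 1 < ((⌊b⌋₊ + 1 - ⌈a⌉₊ : ℕ) : ℝ) := by
    have : ((⌊b⌋₊ + 1 : ℕ) : ℝ) ≤ ((⌊b⌋₊ + 1 - ⌈a⌉₊ : ℕ) : ℝ) + (⌈a⌉₊ : ℝ) := by
      exact_mod_cast (by lia : ⌊b⌋₊ + 1 ≤ (⌊b⌋₊ + 1 - ⌈a⌉₊) + ⌈a⌉₊)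
    push_cast at this
    linarith
  have hup : ((⌊b⌋₊ + 1 - ⌈a⌉₊ : ℕ) : ℝ) ≤ max 0 (b - a + 1) := by
    rcases le_total ⌈a⌉₊ (⌊b⌋₊ + 1) with h | h
    · rw [Nat.cast_sub h]
      push_cast
      exact le_max_of_le_right (by linarith)
    · rw [Nat.sub_eq_zero_of_le h]
      simp
  set x : ℝ := √(r : ℝ) with hx
  have hx2 : x ^ 2 = r := Real.sq_sqrt (by linarith)
  have hx0 : 0 ≤ x := Real.sqrt_nonneg _
  have hx24 : (2.4 : ℝ) ≤ x := Real.le_sqrt_of_sq_le (by linarith)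
  have h2 : √2 ^ 2 = (2 : ℝ) := Real.sq_sqrt (by norm_num)
  have h20 : 0 ≤ √(2 : ℝ) := Real.sqrt_nonneg _
  have h21 : 1 ≤ √(2 : ℝ) := Real.le_sqrt_of_sq_le (by norm_num)
  have hs1 : x ≤ √((r : ℝ) + 2) := Real.sqrt_le_sqrt (by linarith)
  -- The lower estimate loses 1 to rounding, 1/2 in `b - a`, and this constant, so anything up to
  -- 1/2 keeps the total within 2.
  have hs2 : √((r : ℝ) + 2) ≤ x + 0.45 := by
    rw [Real.sqrt_le_left (by linarith)]
    nlinarith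
  have ht1 : 2 * (√2 * x) ≤ √(8 * (r : ℝ) + 1) := by
    refine Real.le_sqrt_of_sq_le ?_
    have : (2 * (√2 * x)) ^ 2 = 4 * (√2 ^ 2 * x ^ 2) := by ring
    rw [this, h2, hx2]
    linarith
  have ht2 : √(8 * (r : ℝ) + 1) ≤ 2 * (√2 * x) + 1 := by
    rw [Real.sqrt_le_left (by positivity)]
    have : (2 * (√2 * x) + 1) ^ 2 = 4 * (√2 ^ 2 * x ^ 2) + 4 * (√2 * x) + 1 := by ring
    rw [this, h2, hx2]
    have : 0 ≤ √2 * x := by positivity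
    linarith
  have hpos : 0 ≤ (√2 - 1) * x := mul_nonneg (by linarith) hx0
  rw [abs_lt]
  constructor
  · have : b - a = (√(8 * (r : ℝ) + 1)) / 2 - 1 / 2 - √((r : ℝ) + 2) := by rw [ha, hb]; ring
    linarith
  · have : b - a = (√(8 * (r : ℝ) + 1)) / 2 - 1 / 2 - √((r : ℝ) + 2) := by rw [ha, hb]; ring
    rcases max_cases 0 (b - a + 1) with ⟨h, -⟩ | ⟨h, -⟩ <;> rw [h] at hup <;> linarith

end Counting

end PointsMRC

/-! ### The main theorem -/

theorem theorem1p1 (k : Type u) [Field k] :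
    (∀ r γ : ℕ, 6 ≤ r → r ≠ 9 →
      (r : ℝ) + 2 + √((r : ℝ) + 2) ≤ (γ : ℝ) →
      (γ : ℝ) ≤ (r : ℝ) + (3 + √(8 * (r : ℝ) + 1)) / 2 →
      PointsMRC.MRCFails k r γ) ∧
    PointsMRC.MRCFails k 8 13 ∧
    PointsMRC.MRCFails k 15 21 ∧
    (∀ r : ℕ, 6 ≤ r → r ≠ 9 →
      |(Set.ncard {γ : ℕ | (r : ℝ) + 2 + √((r : ℝ) + 2) ≤ (γ : ℝ) ∧
          (γ : ℝ) ≤ (r : ℝ) + (3 + √(8 * (r : ℝ) + 1)) / 2} : ℝ)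
        - (√2 - 1) * √(r : ℝ)| < 2) := by
  refine ⟨?_, ?_, ?_, fun r hr _ => PointsMRC.abs_ncard_sub_lt hr⟩
  · intro r γ hr _ h1 h2
    have hsq := Real.sqrt_nonneg ((r : ℝ) + 2)
    obtain ⟨s, rfl⟩ : ∃ s, γ = r + s + 2 := by
      have : r + 2 ≤ γ := by
        have : ((r + 2 : ℕ) : ℝ) ≤ γ := by push_cast; linarith
        exact_mod_cast this
      exact ⟨γ - r - 2, by lia⟩
    push_cast at h1 h2
    refine PointsMRC.mrcFails_of_le hr ?_ ?_
    · have h3 : √((r : ℝ) + 2) ≤ s := by linarith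
      rw [Real.sqrt_le_left (by positivity)] at h3
      exact_mod_cast h3
    · have h3 : 2 * (s : ℝ) + 1 ≤ √(8 * (r : ℝ) + 1) := by linarith
      rw [Real.le_sqrt (by positivity) (by positivity)] at h3
      have h4 : (s : ℝ) * (s + 1) ≤ 2 * r := by nlinarith
      exact_mod_cast h4
  -- Here y = 13 - C(5,2): there are 10 cubics in 3 variables, against the expected number 8.
  · refine PointsMRC.mrcFails_of_lt k (q := 2) (i := 5) (y := 3) ?_ ?_ ?_ ?_ ?_ <;>
      norm_num [Nat.choose, Nat.multichoose]
  -- Here y = 21 - C(6,2): there are 126 quartics in 6 variables, against the expected number 105.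
  · refine PointsMRC.mrcFails_of_lt k (q := 3) (i := 11) (y := 6) ?_ ?_ ?_ ?_ ?_ <;>
      norm_num [Nat.choose, Nat.multichoose]
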